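/- Let $\alpha>0$ and let $(a_n)_{n\ge1}$ be a sequence of positive real numbers that is regularly varying with index $\alpha$, i.e. $a_{\lfloor cn\rfloor}/a_n\to c^{\alpha}$ as $n\to\infty$ for every $c>0$. Build random rooted trees $(T_n)_{n\ge1}$ recursively: $T_1$ is a closed segment $\mathsf b_1$ of length $a_1$, rooted at one of its two extremities, and, for $n\ge2$, given $T_{n-1}$, the tree $T_n$ is obtained by gluing one extremity of a closed segment $\mathsf b_n$ of length $a_n$ on a point of $T_{n-1}$ chosen according to the normalized length measure of $T_{n-1}$. Let $d$ be the length metric. Let $L_n$ be the extremity of $\mathsf b_n$ that is not glued (for $n=1$, the one that is not the root), so that $L_1,\dots,L_n$ are the $n$ leaves of $T_n$, and, given $T_n$, let $L_{n,\star}$ be chosen uniformly at random among $L_1,\dots,L_n$. There is a unique probability distribution on $\mathbb R$, the law of a random variable denoted $\xi_{(\alpha)}$, such that $$\mathbb E\big[\exp(\lambda\xi_{(\alpha)})\big]=\exp\left(\frac{\alpha+1}{\alpha}\int_0^1\big(e^{\lambda u}-1\big)\frac{1-u}{u}\,\mathrm du\right)\qquad\text{for all }\lambda\in\mathbb R,$$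 and, as $n\to\infty$, $$\frac{d(L_n,\mathsf{root})}{a_n}\xrightarrow{(\mathrm d)}1+\xi_{(\alpha)}\qquad\text{and}\qquad\frac{d(L_{n,\star},\mathsf{root})}{a_n}\xrightarrow{(\mathrm d)}(1+\xi_{(\alpha)})\,U^{\alpha},$$ where $U$ is uniform on $(0,1)$ and independent of $\xi_{(\alpha)}$. -/

import Mathlib

open MeasureTheory ProbabilityTheory Filter Topology

noncomputable section

/-- `(a_n)_{n ≥ 1}` is regularly varying with index `α`: for all `c > 0`,
`a_{⌊c n⌋} / a_n → c ^ α`. The value `a 0` plays no role. -/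
def RegularlyVarying (a : ℕ → ℝ) (α : ℝ) : Prop :=
  ∀ c : ℝ, 0 < c →
    Tendsto (fun n : ℕ => a ⌊c * (n : ℝ)⌋₊ / a n) atTop (𝓝 (c ^ α))

namespace LineBreaking

/-- The tree `T_n`, as a set of points. A pair `(k, s)` stands for the point of the closed
segment `b_k` of length `a_k` that lies at distance `s` from the extremity of `b_k` by which this
segment is glued (for `k = 1`: from the root). The only identifications, encoded by `treeDist`
below, are between `(k, 0)`, `k ≥ 2`, and the point of `T_{k-1}` on which `b_k` is glued. -/
def tree (a : ℕ → ℝ) (n : ℕ) : Set (ℕ × ℝ) :=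
  {p | 1 ≤ p.1 ∧ p.1 ≤ n ∧ 0 ≤ p.2 ∧ p.2 ≤ a p.1}

/-- The length measure on the disjoint union of the segments. -/
def lengthMeasure : Measure (ℕ × ℝ) := (Measure.count : Measure ℕ).prod (volume : Measure ℝ)

/-- The length metric on `T_n`, where `g k` is the point of `T_k` on which the segment `b_{k+1}`
is glued. `T_{n+1}` is `T_n` together with `b_{n+1}`, whose extremity `(n + 1, 0)` is glued
on `g n`. (For `n = 0` the tree is empty, so `T_1` is just the segment `b_1`.) -/
def treeDist (g : ℕ → ℕ × ℝ) : ℕ → ℕ × ℝ → ℕ × ℝ → ℝ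
  | 0, _, _ => 0
  | n + 1, p, q =>
    if p.1 ≤ n then
      if q.1 ≤ n then treeDist g n p q else treeDist g n p (g n) + q.2
    else
      if q.1 ≤ n then p.2 + treeDist g n (g n) q else |p.2 - q.2|

/-- The root: one of the two extremities of `b_1`. -/
def root : ℕ × ℝ := (1, 0)

/-- The `n`-th leaf `L_n`: the extremity of `b_n` that is not glued
(for `n = 1`: that is not the root). -/
def leaf (a : ℕ → ℝ) (n : ℕ) : ℕ × ℝ := (n, a n)

/-- `X n`, `n ≥ 1`, are the random gluing points of the construction: given `T_n` (that is, given
`X 1, …, X (n - 1)`), the segment `b_{n+1}` is glued on the point `X n`, which is uniform on `T_n`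
for the normalized length measure. The variable `X 0` plays no role. -/
structure IsGluing {Ω : Type*} [MeasurableSpace Ω] (P : Measure Ω) (a : ℕ → ℝ)
    (X : ℕ → Ω → ℕ × ℝ) : Prop where
  measurable : ∀ n, 1 ≤ n → Measurable (X n)
  uniform : ∀ n, 1 ≤ n → pdf.IsUniform (X n) (tree a n) P lengthMeasure
  indep : iIndepFun (fun n : ℕ => X (n + 1)) P

/-- `J` is uniform on `{1, …, n}` and independent of the tree `T_n`, so that `L_J` is a leaf chosen
uniformly at random amongst the `n` leaves `L_1, …, L_n` of `T_n`. -/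
structure IsUniformLeafIndex {Ω : Type*} [MeasurableSpace Ω] (P : Measure Ω)
    (X : ℕ → Ω → ℕ × ℝ) (n : ℕ) (J : Ω → ℕ) : Prop where
  measurable : Measurable J
  uniform : pdf.IsUniform J (Set.Icc 1 n) P Measure.count
  indep : IndepFun J (fun ω (k : Finset.Ico 1 n) => X k ω) P

/-- `φ_(α)(t) = (α + 1) / α * ∫_0^1 (exp (t u) - 1) (1 - u) / u du`. -/
def phi (α t : ℝ) : ℝ :=
  (α + 1) / α * ∫ u in (0 : ℝ)..1, (Real.exp (t * u) - 1) * ((1 - u) / u)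

/-- `ν` is the law of `ξ_(α)`: its Laplace transform is finite everywhere, equal to
`exp (φ_(α))`. -/
def IsXiLaw (α : ℝ) (ν : Measure ℝ) : Prop :=
  ∀ t : ℝ, Integrable (fun x => Real.exp (t * x)) ν ∧
    ∫ x, Real.exp (t * x) ∂ν = Real.exp (phi α t)

end LineBreaking

end

/-! Write `A_k = a_1 + ... + a_k` and let `H_n` be the height of `X n`, uniform on `T_n`. With
probability `a_n / A_n` the point `X n` lies on the last segment, at a uniform position there, and
its height is that position plus an independent copy of `H_{n-1}`; otherwise it is uniform on
`T_{n-1}`. So `H_n` has the law of a sum of independent variables `B_k a_k V_k`, `k ≤ n`, with `B_k`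
Bernoulli of parameter `a_k / A_k` and `V_k` uniform on `(0, 1)`. In terms of moment generating
functions this is the product formula `integral_exp_treeDist`.

Replace `t` by `t / a_n` and take logarithms. Karamata's theorem (`tendsto_sum_div`) gives `k a_k /
A_k → α + 1`, regular variation gives `a_{⌊xn⌋} / a_n → x ^ α`, and the sum becomes a Riemann sum
for `∫ (α + 1) / x * expMean (t x ^ α)`, which equals `phi α t` by `phi_eq`. A Potter bound
(`exists_le_mul_rpow_mul`) supplies the domination. Convergence of moment generating functions
yields weak convergence, and also the existence of the law of `ξ`.

The height of `L_{n+1}` is `a_{n+1} + H_n`, hence the first limit. For a uniform leaf, average over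
the index `k = ⌊xn⌋`: the height of `L_k` divided by `a_n` tends to `(1 + ξ) x ^ α` in law, and the
average over `k` becomes the integral over `x`, that is, over `U`. -/

namespace MeasureTheory

/-! ### Moment generating functions and weak convergence. -/

/-- A probability measure on `ℝ` with everywhere finite moment generating function is determined
by that function. -/
theorem ProbabilityMeasure.eq_of_integral_exp_mul_eq {μ ν : ProbabilityMeasure ℝ}
    (hμ : ∀ t : ℝ, Integrable (fun x => Real.exp (t * x)) (μ : Measure ℝ))
    (h : ∀ t : ℝ, ∫ x, Real.exp (t * x) ∂(μ : Measure ℝ) = ∫ x, Real.exp (t * x) ∂(ν : Measure ℝ)) :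
    μ = ν := by
  apply Subtype.ext
  refine Measure.ext_of_complexMGF_id_eq (μ := (μ : Measure ℝ)) (μ' := (ν : Measure ℝ)) ?_
  have h1 : mgf id (μ : Measure ℝ) = mgf id (ν : Measure ℝ) := by
    funext t
    exact h t
  have h2 : integrableExpSet id (μ : Measure ℝ) = Set.univ := by
    ext t
    simpa [integrableExpSet] using hμ t
  -- Analytic continuation from the real line: the strip of definition is the whole plane.
  funext z
  exact eqOn_complexMGF_of_mgf h1 (by simp [h2])

/-- The weak limit of measures whose moment generating functions converge pointwise has the limit
as its moment generating function. -/
theorem ProbabilityMeasure.integral_exp_mul_of_tendsto {ι : Type*} {l : Filter ι} [l.NeBot]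
    {μ : ι → ProbabilityMeasure ℝ} {ν : ProbabilityMeasure ℝ} {M : ℝ → ℝ}
    (hμν : Tendsto μ l (𝓝 ν))
    (hint : ∀ i (t : ℝ), Integrable (fun x => Real.exp (t * x)) (μ i : Measure ℝ))
    (hM : ∀ t : ℝ, Tendsto (fun i => ∫ x, Real.exp (t * x) ∂(μ i : Measure ℝ)) l (𝓝 (M t)))
    (t : ℝ) :
    Integrable (fun x => Real.exp (t * x)) (ν : Measure ℝ) ∧
      ∫ x, Real.exp (t * x) ∂(ν : Measure ℝ) = M t := by
  rw [ProbabilityMeasure.tendsto_iff_forall_integral_tendsto] at hμν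
  -- The exponential is unbounded, so weak convergence is tested on its truncations at height `K`.
  let f (K : ℕ) : BoundedContinuousFunction ℝ ℝ :=
    BoundedContinuousFunction.ofNormedAddCommGroup (fun x => min (Real.exp (t * x)) K)
      (by fun_prop) K (fun x => by
        rw [Real.norm_of_nonneg (le_min (Real.exp_pos _).le (Nat.cast_nonneg _))]
        exact min_le_right _ _)
  have hf (K : ℕ) (x : ℝ) : f K x = min (Real.exp (t * x)) K := rfl
  have hfi (K : ℕ) (m : ProbabilityMeasure ℝ) : Integrable (f K) (m : Measure ℝ) :=
    (f K).integrable _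
  have hle (K : ℕ) : ∫ x, f K x ∂(ν : Measure ℝ) ≤ M t := by
    refine le_of_tendsto_of_tendsto' (hμν (f K)) (hM t) fun i => ?_
    exact integral_mono (hfi K _) (hint i t) fun x => min_le_left _ _
  -- Uniform integrability from the exponent `2 * t`: `e^y ≤ min (e^y) K + e^(2y) / K`.
  have hge (K : ℕ) (hK : 0 < K) : M t ≤ ∫ x, f K x ∂(ν : Measure ℝ) + M (2 * t) / K := by
    refine le_of_tendsto_of_tendsto' (hM t) ((hμν (f K)).add ((hM (2 * t)).div_const (K : ℝ)))
      fun i => ?_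
    rw [← integral_div, ← integral_add (hfi K _) ((hint i (2 * t)).div_const _)]
    refine integral_mono (hint i t) ((hfi K _).add ((hint i (2 * t)).div_const _)) fun x => ?_
    have hK' : (0 : ℝ) < K := by exact_mod_cast hK
    have hexp : Real.exp (2 * t * x) = Real.exp (t * x) * Real.exp (t * x) := by
      rw [← Real.exp_add]; ring_nf
    simp only [hf]
    rcases le_total (Real.exp (t * x)) K with h | h
    · rw [min_eq_left h]
      have : 0 ≤ Real.exp (2 * t * x) / K := by positivity
      linarith
    · rw [min_eq_right h, hexp]
      have : Real.exp (t * x) ≤ Real.exp (t * x) * Real.exp (t * x) / K := by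
        rw [le_div_iff₀ hK']
        exact mul_le_mul_of_nonneg_left h (Real.exp_pos _).le
      linarith
  have hmono : ∀ x : ℝ, Tendsto (fun K : ℕ => f K x) atTop (𝓝 (Real.exp (t * x))) := by
    intro x
    apply tendsto_const_nhds.congr'
    filter_upwards [eventually_ge_atTop ⌈Real.exp (t * x)⌉₊] with K hK
    rw [hf, min_eq_left (Nat.ceil_le.1 hK)]
  have hI : Integrable (fun x => Real.exp (t * x)) (ν : Measure ℝ) := by
    refine ⟨by fun_prop, ?_⟩
    have h1 : ∫⁻ x, ‖Real.exp (t * x)‖ₑ ∂(ν : Measure ℝ) ≤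
        liminf (fun K : ℕ => ∫⁻ x, ‖f K x‖ₑ ∂(ν : Measure ℝ)) atTop :=
      lintegral_enorm_le_liminf_of_tendsto (ae_of_all _ hmono)
        (fun K => (f K).continuous.measurable.enorm.aemeasurable)
    refine (h1.trans (liminf_le_of_le (a := ENNReal.ofReal (M t)) (by isBoundedDefault)
      fun b hb => ?_)).trans_lt ENNReal.ofReal_lt_top
    obtain ⟨K, hK⟩ := hb.exists
    refine hK.trans ?_
    rw [← ofReal_integral_norm_eq_lintegral_enorm (hfi K ν)]
    refine ENNReal.ofReal_le_ofReal (le_trans (le_of_eq ?_) (hle K))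
    refine integral_congr_ae (ae_of_all _ fun x => ?_)
    exact Real.norm_of_nonneg (le_min (Real.exp_pos _).le (Nat.cast_nonneg _))
  refine ⟨hI, ?_⟩
  have hlim : Tendsto (fun K : ℕ => ∫ x, f K x ∂(ν : Measure ℝ)) atTop
      (𝓝 (∫ x, Real.exp (t * x) ∂(ν : Measure ℝ))) := by
    refine tendsto_integral_of_dominated_convergence _ (fun K => (hfi K ν).1) hI (fun K => ?_)
      (ae_of_all _ hmono)
    refine ae_of_all _ fun x => ?_
    rw [hf, Real.norm_of_nonneg (le_min (Real.exp_pos _).le (Nat.cast_nonneg _))]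
    exact min_le_left _ _
  apply le_antisymm (le_of_tendsto' hlim hle)
  have h0 := hlim.add (tendsto_const_div_atTop_nhds_zero_nat (M (2 * t)))
  rw [add_zero] at h0
  refine ge_of_tendsto h0 ?_
  filter_upwards [eventually_gt_atTop 0] with K hK using hge K hK

/-- A sequence of measures on `ℝ` whose moment generating functions converge pointwise is tight. -/
theorem isTightMeasureSet_of_tendsto_integral_exp_mul {μ : ℕ → ProbabilityMeasure ℝ} {M : ℝ → ℝ}
    (hint : ∀ n (t : ℝ), Integrable (fun x => Real.exp (t * x)) (μ n : Measure ℝ))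
    (hM : ∀ t : ℝ, Tendsto (fun n => ∫ x, Real.exp (t * x) ∂(μ n : Measure ℝ)) atTop (𝓝 (M t))) :
    IsTightMeasureSet {((m : ProbabilityMeasure ℝ) : Measure ℝ) | m ∈ Set.range μ} := by
  -- Chernoff bound: the exponents `1` and `-1` control the right and left tails.
  obtain ⟨C, hC⟩ := ((hM 1).add (hM (-1))).bddAbove_range
  have hC' (n : ℕ) : ∫ x, (Real.exp (1 * x) + Real.exp (-1 * x)) ∂(μ n : Measure ℝ) ≤ C := by
    rw [integral_add (hint n 1) (hint n (-1))]
    exact hC ⟨n, rfl⟩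
  have hbound (n : ℕ) (r : ℝ) :
      (μ n : Measure ℝ) {x | r < ‖x‖} ≤ ENNReal.ofReal (C * Real.exp (-r)) := by
    have h1 := mul_meas_ge_le_integral_of_nonneg (μ := (μ n : Measure ℝ))
      (f := fun x => Real.exp (1 * x) + Real.exp (-1 * x))
      (ae_of_all _ fun x => by positivity) ((hint n 1).add (hint n (-1))) (Real.exp r)
    rw [← ofReal_measureReal]
    refine ENNReal.ofReal_le_ofReal ?_
    have h2 : (μ n : Measure ℝ).real {x | r < ‖x‖} ≤
        (μ n : Measure ℝ).real {x | Real.exp r ≤ Real.exp (1 * x) + Real.exp (-1 * x)} := by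
      refine measureReal_mono fun x hx => ?_
      have hx' : r < |x| := hx
      simp only [Set.mem_ofPred_eq]
      rcases lt_abs.1 hx' with h | h
      · have := Real.exp_le_exp.2 h.le
        have h3 := Real.exp_pos (-1 * x)
        rw [one_mul]; linarith
      · have := Real.exp_le_exp.2 h.le
        have h3 := Real.exp_pos (1 * x)
        rw [neg_one_mul]; linarith
    have h3 : Real.exp r * (μ n : Measure ℝ).real {x | r < ‖x‖} ≤ C :=
      (mul_le_mul_of_nonneg_left h2 (Real.exp_pos r).le).trans (h1.trans (hC' n))
    rw [Real.exp_neg, ← div_eq_mul_inv, le_div_iff₀ (Real.exp_pos r), mul_comm]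
    exact h3
  refine isTightMeasureSet_of_tendsto_measure_norm_gt ?_
  have hlim : Tendsto (fun r : ℝ => ENNReal.ofReal (C * Real.exp (-r))) atTop (𝓝 0) := by
    rw [← ENNReal.ofReal_zero]
    refine ENNReal.tendsto_ofReal ?_
    simpa using (Real.tendsto_exp_neg_atTop_nhds_zero).const_mul C
  refine tendsto_of_tendsto_of_tendsto_of_le_of_le tendsto_const_nhds hlim (fun _ => zero_le)
    fun r => ?_
  refine iSup₂_le fun m hm => ?_
  obtain ⟨_, ⟨n, rfl⟩, rfl⟩ := hm
  exact hbound n r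

/-- If the moment generating functions of a sequence of probability measures converge everywhere,
then the measures converge weakly, to a measure with the limit as moment generating function. -/
theorem exists_tendsto_of_tendsto_integral_exp_mul {μ : ℕ → ProbabilityMeasure ℝ} {M : ℝ → ℝ}
    (hint : ∀ n (t : ℝ), Integrable (fun x => Real.exp (t * x)) (μ n : Measure ℝ))
    (hM : ∀ t : ℝ, Tendsto (fun n => ∫ x, Real.exp (t * x) ∂(μ n : Measure ℝ)) atTop (𝓝 (M t))) :
    ∃ ν : ProbabilityMeasure ℝ, Tendsto μ atTop (𝓝 ν) ∧
      ∀ t : ℝ, Integrable (fun x => Real.exp (t * x)) (ν : Measure ℝ) ∧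
        ∫ x, Real.exp (t * x) ∂(ν : Measure ℝ) = M t := by
  have hcomp : IsCompact (closure (Set.range μ)) :=
    isCompact_closure_of_isTightMeasureSet (isTightMeasureSet_of_tendsto_integral_exp_mul hint hM)
  -- By Prokhorov every ultrafilter has a limit; its moment generating function is `M`, so all these
  -- limits coincide.
  have key (U : Ultrafilter ℕ) (hU : (U : Filter ℕ) ≤ atTop) :
      ∃ ν : ProbabilityMeasure ℝ, Tendsto μ U (𝓝 ν) ∧
        ∀ t : ℝ, Integrable (fun x => Real.exp (t * x)) (ν : Measure ℝ) ∧
          ∫ x, Real.exp (t * x) ∂(ν : Measure ℝ) = M t := by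
    obtain ⟨ν, -, hν⟩ := hcomp.ultrafilter_le_nhds (U.map μ)
      (.trans (by simp) (monotone_principal subset_closure))
    have hν' : Tendsto μ U (𝓝 ν) := hν
    exact ⟨ν, hν', fun t =>
      ProbabilityMeasure.integral_exp_mul_of_tendsto hν' hint (fun t => (hM t).mono_left hU) t⟩
  obtain ⟨ν, -, hν⟩ := key (hyperfilter ℕ) Nat.hyperfilter_le_atTop
  refine ⟨ν, (Filter.tendsto_iff_ultrafilter _ _ _).2 fun U hU => ?_, hν⟩
  obtain ⟨ν', hν', hνM⟩ := key U hU
  rwa [ProbabilityMeasure.eq_of_integral_exp_mul_eq (μ := ν) (ν := ν') (fun t => (hν t).1)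
    (fun t => (hν t).2.trans (hνM t).2.symm)]

end MeasureTheory

/-! ### Bounds for regularly varying sequences. -/

namespace RegularlyVarying

variable {a : ℕ → ℝ} {α : ℝ}

/-- Convergence is assumed only for each fixed `c`, while `n / l` varies here. As in Egorov's
theorem, the ratios are controlled uniformly for `c` off a set of small measure, and some `x` is
good relative to both `l` and `n`; `a l` and `a n` are then compared through `a ⌊x⌋₊`. -/
theorem exists_le_mul_of_le_two_mul (hreg : RegularlyVarying a α) (hα : 0 < α)
    (ha : ∀ n, 1 ≤ n → 0 < a n) :
    ∃ C : ℝ, 0 < C ∧ ∃ N : ℕ, 1 ≤ N ∧ ∀ l n, N ≤ l → l ≤ n → n ≤ 2 * l → a l ≤ C * a n := by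
  -- For `c` in `[1, 4]` the limit `c ^ α` lies strictly between `1 / 2` and `K`.
  set K : ℝ := 4 ^ α + 1 with hK
  have hKpos : 0 < K := by positivity
  let B (N : ℕ) : Set ℝ := {c | c ∈ Set.Icc (1 : ℝ) 4 ∧
    ∃ n ≥ N, ¬ (1 / 2 ≤ a ⌊c * (n : ℝ)⌋₊ / a n ∧ a ⌊c * (n : ℝ)⌋₊ / a n ≤ K)}
  have hmeas (n : ℕ) : Measurable fun c : ℝ => a ⌊c * (n : ℝ)⌋₊ / a n :=
    ((measurable_from_nat (f := a)).comp
      (Nat.measurable_floor.comp (measurable_mul_const _))).div_const _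
  have hBm (N : ℕ) : MeasurableSet (B N) := by
    have : B N = Set.Icc (1 : ℝ) 4 ∩ ⋃ n, ⋃ (_ : n ≥ N),
        ({c : ℝ | 1 / 2 ≤ a ⌊c * (n : ℝ)⌋₊ / a n} ∩ {c | a ⌊c * (n : ℝ)⌋₊ / a n ≤ K})ᶜ := by
      ext c
      simp [B, Set.mem_iUnion]
    rw [this]
    exact measurableSet_Icc.inter <| MeasurableSet.iUnion fun n => MeasurableSet.iUnion fun _ =>
      ((measurableSet_le measurable_const (hmeas n)).inter
        (measurableSet_le (hmeas n) measurable_const)).compl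
  have hBanti : Antitone B := fun N N' hN c hc =>
    ⟨hc.1, hc.2.imp fun n hn => ⟨hN.trans hn.1, hn.2⟩⟩
  have hBempty : ⋂ N, B N = ∅ := by
    rw [Set.eq_empty_iff_forall_notMem]
    intro c hc
    rw [Set.mem_iInter] at hc
    have hc1 := (hc 0).1
    have hlim := hreg c (by linarith [hc1.1])
    have h1 : (1 : ℝ) / 2 < c ^ α := by
      have := Real.one_le_rpow hc1.1 hα.le
      linarith
    have h2 : c ^ α < K := by
      have := Real.rpow_le_rpow (by linarith [hc1.1]) hc1.2 hα.le
      linarith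
    have hev := (hlim.eventually (lt_mem_nhds h1)).and (hlim.eventually (gt_mem_nhds h2))
    obtain ⟨N, hN⟩ := eventually_atTop.1 hev
    obtain ⟨n, hn, hn'⟩ := (hc N).2
    exact hn' ⟨(hN n hn).1.le, (hN n hn).2.le⟩
  have hlim : Tendsto (fun N => volume (B N)) atTop (𝓝 0) := by
    have := tendsto_measure_iInter_atTop (μ := volume) (s := B)
      (fun N => (hBm N).nullMeasurableSet) hBanti
      ⟨0, ((measure_mono fun c hc => hc.1).trans_lt
        (by rw [Real.volume_Icc]; exact ENNReal.ofReal_lt_top) : volume (B 0) < ⊤).ne⟩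
    rwa [hBempty, measure_empty] at this
  obtain ⟨N, hN1, hN⟩ := ((eventually_ge_atTop 1).and
    (hlim.eventually (gt_mem_nhds (show (0 : ENNReal) < ENNReal.ofReal (1 / 2) by simp)))).exists
  refine ⟨2 * K, by positivity, N, hN1, fun l n hl hln hn2 => ?_⟩
  have hl0 : (0 : ℝ) < l := by exact_mod_cast hN1.trans hl
  have hln' : (l : ℝ) ≤ n := by exact_mod_cast hln
  have hn2' : (n : ℝ) ≤ 2 * l := by exact_mod_cast hn2
  have hn0 : (0 : ℝ) < n := hl0.trans_le hln'
  -- The interval has length `2 l`, whereas the two bad sets have total measure at most `l / 2 + n /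
  -- 2 ≤ 3 l / 2`.
  obtain ⟨x, hx, hxl, hxn⟩ : ∃ x ∈ Set.Icc (2 * l : ℝ) (4 * l), x / l ∉ B N ∧ x / n ∉ B N := by
    by_contra! hcon
    have hpre (m : ℝ) (hm : 0 < m) :
        volume ((fun x : ℝ => x * m⁻¹) ⁻¹' B N) ≤ ENNReal.ofReal (m / 2) := by
      rw [Real.volume_preimage_mul_right (inv_pos.2 hm).ne', inv_inv, abs_of_pos hm,
        div_eq_mul_one_div, ENNReal.ofReal_mul hm.le]
      gcongr
    have hsub : Set.Icc (2 * l : ℝ) (4 * l) ⊆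
        ((fun x : ℝ => x * (l : ℝ)⁻¹) ⁻¹' B N) ∪ ((fun x : ℝ => x * (n : ℝ)⁻¹) ⁻¹' B N) := by
      intro x hx
      by_cases h : x / l ∈ B N
      · exact Or.inl (by simpa [div_eq_mul_inv] using h)
      · exact Or.inr (by simpa [div_eq_mul_inv] using hcon x hx h)
    have h1 := (measure_mono hsub).trans (measure_union_le (μ := volume) _ _)
    have h2 := h1.trans (add_le_add (hpre l hl0) (hpre n hn0))
    rw [Real.volume_Icc, ← ENNReal.ofReal_add (by positivity) (by positivity),
      ENNReal.ofReal_le_ofReal_iff (by positivity)] at h2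
    linarith
  have hxl' : x / l ∈ Set.Icc (1 : ℝ) 4 := by
    rw [Set.mem_Icc, le_div_iff₀ hl0, div_le_iff₀ hl0]
    exact ⟨by linarith [hx.1], hx.2⟩
  have hxn' : x / n ∈ Set.Icc (1 : ℝ) 4 := by
    rw [Set.mem_Icc, le_div_iff₀ hn0, div_le_iff₀ hn0]
    exact ⟨by linarith [hx.1], by linarith [hx.2]⟩
  have e1 : 1 / 2 ≤ a ⌊x / l * (l : ℝ)⌋₊ / a l := by
    by_contra h
    exact hxl ⟨hxl', l, hl, fun h' => h h'.1⟩
  have e2 : a ⌊x / n * (n : ℝ)⌋₊ / a n ≤ K := by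
    by_contra h
    exact hxn ⟨hxn', n, hl.trans hln, fun h' => h h'.2⟩
  rw [div_mul_cancel₀ _ hl0.ne', le_div_iff₀ (ha l (hN1.trans hl))] at e1
  rw [div_mul_cancel₀ _ hn0.ne', div_le_iff₀ (ha n (hN1.trans (hl.trans hln)))] at e2
  linarith

/-- A Potter-type bound. -/
theorem exists_le_mul_rpow_mul (hreg : RegularlyVarying a α) (hα : 0 < α)
    (ha : ∀ n, 1 ≤ n → 0 < a n) {β : ℝ} (hβ : 0 < β) (hβα : β < α) :
    ∃ C : ℝ, 0 < C ∧ ∀ k n : ℕ, 1 ≤ k → k ≤ n → a k ≤ C * ((k : ℝ) / n) ^ β * a n := by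
  obtain ⟨C, hC, N₁, hN₁, hCN⟩ := hreg.exists_le_mul_of_le_two_mul hα ha
  have h2 : (2 : ℝ) ^ β < 2 ^ α := Real.rpow_lt_rpow_of_exponent_lt (by norm_num) hβα
  obtain ⟨N₂, hN₂⟩ := eventually_atTop.1 ((hreg 2 (by norm_num)).eventually (lt_mem_nhds h2))
  have hdouble (k : ℕ) (hk : max N₁ N₂ ≤ k) : 2 ^ β * a k ≤ a (2 * k) := by
    have h := hN₂ k ((le_max_right _ _).trans hk)
    have hfl : ⌊(2 : ℝ) * (k : ℝ)⌋₊ = 2 * k := by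
      rw [show (2 : ℝ) * (k : ℝ) = ((2 * k : ℕ) : ℝ) by push_cast; ring, Nat.floor_natCast]
    rw [hfl, lt_div_iff₀ (ha k (hN₁.trans ((le_max_left _ _).trans hk)))] at h
    exact h.le
  set N := max N₁ N₂ with hN
  have hNpos : 1 ≤ N := hN₁.trans (le_max_left _ _)
  -- Induction on the gap: `k` is doubled, gaining `2 ^ β` each time, until `n ≤ 2 * k`; the factor
  -- `2` inside the power makes it at least `1` in that last case.
  have hlarge : ∀ d k n : ℕ, n - k ≤ d → N ≤ k → k ≤ n →
      a k ≤ C * (2 * (k : ℝ) / n) ^ β * a n := by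
    intro d
    induction d with
    | zero =>
      intro k n hd hk hkn
      obtain rfl : k = n := by omega
      have hk0 : (0 : ℝ) < k := by exact_mod_cast hNpos.trans hk
      have h1 := hCN k k ((le_max_left _ _).trans hk) le_rfl (by omega)
      refine h1.trans (mul_le_mul_of_nonneg_right ?_ (ha k (hNpos.trans hk)).le)
      refine le_mul_of_one_le_right hC.le (Real.one_le_rpow ?_ hβ.le)
      rw [le_div_iff₀ hk0]; linarith
    | succ d ih =>
      intro k n hd hk hkn
      have hk0 : (0 : ℝ) < k := by exact_mod_cast hNpos.trans hk
      have hn0 : (0 : ℝ) < n := by exact_mod_cast hNpos.trans (hk.trans hkn)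
      have han := ha n (hNpos.trans (hk.trans hkn))
      by_cases h : n ≤ 2 * k
      · have h1 := hCN k n ((le_max_left _ _).trans hk) hkn h
        refine h1.trans (mul_le_mul_of_nonneg_right ?_ han.le)
        refine le_mul_of_one_le_right hC.le (Real.one_le_rpow ?_ hβ.le)
        rw [le_div_iff₀ hn0]
        have : (n : ℝ) ≤ 2 * k := by exact_mod_cast h
        linarith
      · have h1 := ih (2 * k) n (by omega) (by omega) (by omega)
        have h3 := hdouble k hk
        have h4 : (2 * ((2 * k : ℕ) : ℝ) / n) ^ β = 2 ^ β * (2 * (k : ℝ) / n) ^ β := by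
          rw [← Real.mul_rpow (by norm_num) (by positivity)]
          congr 1
          push_cast
          ring
        rw [h4] at h1
        have h5 : (0 : ℝ) < 2 ^ β := by positivity
        refine le_of_mul_le_mul_left ?_ h5
        calc 2 ^ β * a k ≤ a (2 * k) := h3
          _ ≤ _ := h1
          _ = _ := by ring
  -- the same bound for `b k = a k / k ^ β`, extended downwards to `k = 1`
  let b (k : ℕ) : ℝ := a k / (k : ℝ) ^ β
  have hb (k : ℕ) (hk : 1 ≤ k) : 0 < b k :=
    div_pos (ha k hk) (Real.rpow_pos_of_pos (by exact_mod_cast hk) _)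
  have hdown : ∀ m : ℕ, 1 ≤ m → (∃ D : ℝ, 0 < D ∧ ∀ k n, m ≤ k → k ≤ n → b k ≤ D * b n) →
      ∃ D : ℝ, 0 < D ∧ ∀ k n, 1 ≤ k → k ≤ n → b k ≤ D * b n := by
    intro m hm
    induction m, hm using Nat.le_induction with
    | base => exact id
    | succ m hm ih =>
      rintro ⟨D, hD, hDb⟩
      -- The entries serve `k > m`, `k = n = m`, and `k = m < n` (passing through `m + 1`).
      refine ih ⟨max D (max 1 (b m / b (m + 1) * D)), by positivity, fun k n hk hkn => ?_⟩
      have hbn := hb n (hm.trans (hk.trans hkn))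
      rcases hk.eq_or_lt with rfl | hk
      · rcases hkn.eq_or_lt with rfl | hkn
        · exact le_mul_of_one_le_left hbn.le (le_max_of_le_right (le_max_left _ _))
        · have h1 := hDb (m + 1) n le_rfl hkn
          have hb1 := hb (m + 1) (by omega)
          have h2 : b m ≤ b m / b (m + 1) * D * b n := by
            rw [mul_assoc, div_mul_eq_mul_div, le_div_iff₀ hb1]
            exact mul_le_mul_of_nonneg_left h1 (hb m hm).le
          exact h2.trans (mul_le_mul_of_nonneg_right
            (le_max_of_le_right (le_max_right _ _)) hbn.le)
      · exact (hDb k n hk hkn).trans (mul_le_mul_of_nonneg_right (le_max_left _ _) hbn.le)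
  obtain ⟨D, hD, hDb⟩ := hdown N hNpos ⟨C * 2 ^ β, by positivity, fun k n hk hkn => by
    have hk0 : (0 : ℝ) < k := by exact_mod_cast hNpos.trans hk
    have hn0 : (0 : ℝ) < n := by exact_mod_cast hNpos.trans (hk.trans hkn)
    have h1 := hlarge (n - k) k n le_rfl hk hkn
    rw [Real.div_rpow (by positivity) hn0.le, Real.mul_rpow (by norm_num) hk0.le] at h1
    simp only [b]
    rw [div_le_iff₀ (by positivity)]
    calc a k ≤ _ := h1
      _ = _ := by ring⟩
  refine ⟨D, hD, fun k n hk hkn => ?_⟩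
  have hk0 : (0 : ℝ) < k := by exact_mod_cast hk
  have hn0 : (0 : ℝ) < n := by exact_mod_cast hk.trans hkn
  have h1 := hDb k n hk hkn
  simp only [b] at h1
  rw [div_le_iff₀ (by positivity)] at h1
  rw [Real.div_rpow hk0.le hn0.le]
  calc a k ≤ _ := h1
    _ = _ := by ring

end RegularlyVarying

/-! ### Riemann sums and Karamata's theorem. -/

theorem integral_comp_floor_mul (f : ℕ → ℝ) {n : ℕ} (hn : 0 < n) :
    ∫ x in (0 : ℝ)..1, f ⌊x * (n : ℝ)⌋₊ = (∑ k ∈ Finset.range n, f k) / n := by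
  have hunit (k : ℕ) : Set.EqOn (fun _ : ℝ => f k) (fun y : ℝ => f ⌊y⌋₊)
      (Set.Ico (k : ℝ) (k + 1 : ℕ)) := by
    intro y hy
    have : ⌊y⌋₊ = k := by
      rw [Nat.floor_eq_iff ((Nat.cast_nonneg k).trans hy.1)]
      exact ⟨hy.1, by simpa using hy.2⟩
    simp [this]
  have hae (k : ℕ) : ∀ᵐ y ∂(volume : Measure ℝ), y ∈ Set.uIoc (k : ℝ) (k + 1 : ℕ) →
      f k = f ⌊y⌋₊ := by
    filter_upwards [Measure.ae_ne volume ((k + 1 : ℕ) : ℝ)] with y hy hy'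
    rw [Set.uIoc_of_le (by simp)] at hy'
    exact hunit k ⟨hy'.1.le, lt_of_le_of_ne hy'.2 hy⟩
  have hii (k : ℕ) : IntervalIntegrable (fun y : ℝ => f ⌊y⌋₊) volume (k : ℝ) (k + 1 : ℕ) := by
    refine (intervalIntegrable_const (c := f k)).congr_ae ?_
    exact (ae_restrict_iff' measurableSet_uIoc).2 (hae k)
  have hsum : ∫ y in ((0 : ℕ) : ℝ)..(n : ℝ), f ⌊y⌋₊ = ∑ k ∈ Finset.range n, f k := by
    rw [← intervalIntegral.sum_integral_adjacent_intervals (a := fun k : ℕ => (k : ℝ))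
      (fun k _ => hii k)]
    refine Finset.sum_congr rfl fun k _ => ?_
    rw [← intervalIntegral.integral_congr_ae (hae k)]
    simp
  have hn0 : (n : ℝ) ≠ 0 := by exact_mod_cast hn.ne'
  rw [intervalIntegral.integral_comp_mul_right (fun y => f ⌊y⌋₊) hn0, zero_mul, one_mul,
    smul_eq_mul, inv_mul_eq_div, ← hsum, Nat.cast_zero]

/-- Dominated convergence for Riemann sums. -/
theorem tendsto_sum_Icc_of_dominated {F : ℕ → ℕ → ℝ} {G : ℝ → ℝ} {C β : ℝ} (hβ : 0 < β)
    (hβ1 : β ≤ 1)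
    (hdom : ∀ n k : ℕ, 1 ≤ k → k ≤ n → |F n k| ≤ C * ((k : ℝ) / n) ^ (β - 1) / n)
    (hlim : ∀ x ∈ Set.Ioo (0 : ℝ) 1,
      Tendsto (fun n : ℕ => (n : ℝ) * F n ⌊x * (n : ℝ)⌋₊) atTop (𝓝 (G x))) :
    Tendsto (fun n : ℕ => ∑ k ∈ Finset.Icc 1 n, F n k) atTop (𝓝 (∫ x in (0 : ℝ)..1, G x)) := by
  have hC : 0 ≤ C := by
    have := (abs_nonneg _).trans (hdom 1 1 le_rfl le_rfl)
    simpa using this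
  -- No bound is available at `k = 0`, hence the value `0` there.
  let F' (n k : ℕ) : ℝ := if k = 0 then 0 else n * F n k
  -- Almost everywhere on `(0, 1)` the floor takes values in `0, …, n - 1`; the term `k = n` is left
  -- over and is `O(1 / n)`.
  have hsplit (n : ℕ) (hn : 0 < n) : ∑ k ∈ Finset.Icc 1 n, F n k =
      (∫ x in (0 : ℝ)..1, F' n ⌊x * (n : ℝ)⌋₊) + F n n := by
    have hn0 : (n : ℝ) ≠ 0 := by exact_mod_cast hn.ne'
    rw [integral_comp_floor_mul _ hn, Finset.sum_div]
    obtain ⟨m, rfl⟩ : ∃ m, n = m + 1 := ⟨n - 1, by omega⟩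
    rw [Finset.sum_range_succ', Finset.sum_Icc_succ_top (by omega)]
    simp only [F', if_true, zero_div, add_zero, Nat.succ_ne_zero, if_false,
      mul_div_cancel_left₀ _ hn0]
    congr 1
    rw [← Finset.Ico_add_one_right_eq_Icc, Finset.sum_Ico_eq_sum_range]
    simp [add_comm]
  have hlast : Tendsto (fun n : ℕ => F n n) atTop (𝓝 0) := by
    refine squeeze_zero_norm' ?_ (tendsto_const_div_atTop_nhds_zero_nat C)
    filter_upwards [eventually_gt_atTop 0] with n hn
    have hn0 : (n : ℝ) ≠ 0 := by exact_mod_cast hn.ne'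
    simpa [div_self hn0] using hdom n n hn le_rfl
  have hint : Tendsto (fun n : ℕ => ∫ x in (0 : ℝ)..1, F' n ⌊x * (n : ℝ)⌋₊) atTop
      (𝓝 (∫ x in (0 : ℝ)..1, G x)) := by
    refine intervalIntegral.tendsto_integral_filter_of_dominated_convergence
      (fun x => C * 2 ^ (1 - β) * x ^ (β - 1)) (Eventually.of_forall fun n => ?_) ?_ ?_ ?_
    · exact ((measurable_from_nat (f := F' n)).comp
        (Nat.measurable_floor.comp (measurable_mul_const _))).aestronglyMeasurable
    · filter_upwards [eventually_gt_atTop 0] with n hn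
      refine ae_of_all _ fun x hx => ?_
      rw [Set.uIoc_of_le zero_le_one] at hx
      have hn0 : (0 : ℝ) < n := by exact_mod_cast hn
      simp only [F']
      split_ifs with h
      · rw [norm_zero]
        have := hx.1
        positivity
      · have hk1 : 1 ≤ ⌊x * (n : ℝ)⌋₊ := Nat.one_le_iff_ne_zero.2 h
        have hkn : ⌊x * (n : ℝ)⌋₊ ≤ n := by
          refine Nat.floor_le_of_le ?_
          exact mul_le_of_le_one_left hn0.le hx.2
        have hd := hdom n _ hk1 hkn
        have hk1' : (1 : ℝ) ≤ ⌊x * (n : ℝ)⌋₊ := by exact_mod_cast hk1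
        have hlt := Nat.lt_floor_add_one (x * (n : ℝ))
        -- A number whose floor is at least `1` is less than twice its floor. Since `β - 1 ≤ 0`,
        -- this lower bound dominates the power.
        have hhalf : x / 2 ≤ (⌊x * (n : ℝ)⌋₊ : ℝ) / n := by
          rw [le_div_iff₀ hn0]
          linarith
        rw [norm_mul, Real.norm_of_nonneg hn0.le, Real.norm_eq_abs]
        calc (n : ℝ) * |F n ⌊x * (n : ℝ)⌋₊|
            ≤ n * (C * ((⌊x * (n : ℝ)⌋₊ : ℝ) / n) ^ (β - 1) / n) := by gcongr
          _ = C * ((⌊x * (n : ℝ)⌋₊ : ℝ) / n) ^ (β - 1) := by field_simp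
          _ ≤ C * (x / 2) ^ (β - 1) := by
              refine mul_le_mul_of_nonneg_left ?_ hC
              exact Real.rpow_le_rpow_of_nonpos (half_pos hx.1) hhalf (by linarith)
          _ = C * 2 ^ (1 - β) * x ^ (β - 1) := by
              rw [Real.div_rpow hx.1.le (by norm_num), div_eq_mul_inv,
                ← Real.rpow_neg (by norm_num), neg_sub]
              ring
    · exact (intervalIntegral.intervalIntegrable_rpow' (by linarith)).const_mul _
    · filter_upwards [Measure.ae_ne volume (1 : ℝ)] with x hx1 hx
      rw [Set.uIoc_of_le zero_le_one] at hx
      refine (hlim x ⟨hx.1, lt_of_le_of_ne hx.2 hx1⟩).congr' ?_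
      have hfl : Tendsto (fun n : ℕ => ⌊x * (n : ℝ)⌋₊) atTop atTop :=
        tendsto_nat_floor_atTop.comp (tendsto_natCast_atTop_atTop.const_mul_atTop hx.1)
      filter_upwards [hfl.eventually_gt_atTop 0] with n hn
      simp only [F', if_neg hn.ne']
  have := hint.add hlast
  rw [add_zero] at this
  refine this.congr' ?_
  filter_upwards [eventually_gt_atTop 0] with n hn using (hsplit n hn).symm

namespace RegularlyVarying

variable {a : ℕ → ℝ} {α : ℝ}

/-- Karamata's theorem for the partial sums of a regularly varying sequence. -/
theorem tendsto_sum_div (hreg : RegularlyVarying a α) (hα : 0 < α)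
    (ha : ∀ n, 1 ≤ n → 0 < a n) :
    Tendsto (fun n : ℕ => (∑ k ∈ Finset.Icc 1 n, a k) / (n * a n)) atTop (𝓝 (1 / (α + 1))) := by
  have hβ : 0 < min (α / 2) 1 := by positivity
  have hβα : min (α / 2) 1 < α := (min_le_left _ _).trans_lt (by linarith)
  obtain ⟨C, hC, hCa⟩ := hreg.exists_le_mul_rpow_mul hα ha hβ hβα
  have hint : ∫ x in (0 : ℝ)..1, x ^ α = 1 / (α + 1) := by
    rw [integral_rpow (Or.inl (by linarith)), Real.one_rpow, Real.zero_rpow (by linarith), sub_zero]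
  rw [← hint]
  simp only [Finset.sum_div]
  refine tendsto_sum_Icc_of_dominated (C := C) (β := 1) one_pos le_rfl (fun n k hk hkn => ?_)
    (fun x hx => ?_)
  · have hn0 : (0 : ℝ) < n := by exact_mod_cast hk.trans hkn
    have hk0 : (0 : ℝ) < k := by exact_mod_cast hk
    have hkn' : (k : ℝ) ≤ n := by exact_mod_cast hkn
    have han := ha n (hk.trans hkn)
    have hak := ha k hk
    rw [abs_of_pos (by positivity), sub_self, Real.rpow_zero, mul_one, mul_comm (n : ℝ),
      ← div_div]
    refine div_le_div_of_nonneg_right ?_ hn0.le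
    rw [div_le_iff₀ han]
    refine (hCa k n hk hkn).trans (mul_le_mul_of_nonneg_right ?_ han.le)
    exact mul_le_of_le_one_right hC.le
      (Real.rpow_le_one (by positivity) ((div_le_one hn0).2 hkn') hβ.le)
  · refine (hreg x hx.1).congr' ?_
    filter_upwards [eventually_gt_atTop 0] with n hn
    have hn0 : (n : ℝ) ≠ 0 := by exact_mod_cast hn.ne'
    have := (ha n hn).ne'
    field_simp

end RegularlyVarying

/-! ### The exponent `phi` and the limit of the product. -/

noncomputable section

namespace LineBreaking

/-- `E[exp (s V)] - 1` for `V` uniform on `(0, 1)`. -/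
def expMean (s : ℝ) : ℝ := ∫ v in (0 : ℝ)..1, (Real.exp (s * v) - 1)

theorem abs_exp_sub_one_le_mul_exp (x : ℝ) : |Real.exp x - 1| ≤ |x| * Real.exp |x| := by
  rw [abs_le]
  constructor
  · have h1 := Real.add_one_le_exp x
    have h2 : |x| ≤ |x| * Real.exp |x| :=
      le_mul_of_one_le_right (abs_nonneg x) (Real.one_le_exp (abs_nonneg x))
    have h3 := neg_abs_le x
    linarith
  · have h1 := Real.add_one_le_exp (-x)
    have h2 : Real.exp x - 1 ≤ x * Real.exp x := by
      have h3 : Real.exp x * Real.exp (-x) = 1 := by rw [← Real.exp_add]; simp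
      nlinarith [Real.exp_pos x]
    refine h2.trans ?_
    exact mul_le_mul (le_abs_self x) (Real.exp_le_exp.2 (le_abs_self x)) (Real.exp_pos x).le
      (abs_nonneg x)

theorem abs_expMean_le (s : ℝ) : |expMean s| ≤ |s| * Real.exp |s| := by
  have := intervalIntegral.norm_integral_le_of_norm_le_const (a := (0 : ℝ)) (b := 1)
    (f := fun v => Real.exp (s * v) - 1) (C := |s| * Real.exp |s|) (fun v hv => by
      rw [Set.uIoc_of_le zero_le_one] at hv
      rw [Real.norm_eq_abs]
      refine (abs_exp_sub_one_le_mul_exp _).trans ?_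
      have h1 : |s * v| ≤ |s| := by
        rw [abs_mul, abs_of_pos hv.1]
        exact mul_le_of_le_one_right (abs_nonneg s) hv.2
      gcongr)
  simpa [expMean] using this

/-- Keeps the factors of the product away from `0`, so that logarithms can be taken. -/
theorem exp_neg_abs_le_one_add_expMean (s : ℝ) : Real.exp (-|s|) ≤ 1 + expMean s := by
  have h : ∫ _ in (0 : ℝ)..1, (Real.exp (-|s|) - 1) ≤ expMean s := by
    refine intervalIntegral.integral_mono_on zero_le_one intervalIntegrable_const
      (Continuous.intervalIntegrable (by fun_prop) _ _) fun v hv => ?_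
    have : -|s| ≤ s * v := by
      have h1 : |s * v| ≤ |s| := by
        rw [abs_mul, abs_of_nonneg hv.1]
        exact mul_le_of_le_one_right (abs_nonneg s) hv.2
      linarith [neg_abs_le (s * v)]
    linarith [Real.exp_le_exp.2 this]
  simp at h
  linarith

theorem exp_neg_abs_le_one_add_mul_expMean {p : ℝ} (hp : 0 ≤ p) (hp1 : p ≤ 1) (s : ℝ) :
    Real.exp (-|s|) ≤ 1 + p * expMean s := by
  have h1 := exp_neg_abs_le_one_add_expMean s
  have h2 : Real.exp (-|s|) ≤ 1 := Real.exp_le_one_iff.2 (by simp)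
  nlinarith

/-- Substituting `u = y v` turns the parameter into an endpoint of integration, which gives the
derivative in `y`. -/
theorem mul_expMean (t y : ℝ) :
    y * expMean (t * y) = ∫ u in (0 : ℝ)..y, (Real.exp (t * u) - 1) := by
  have := intervalIntegral.mul_integral_comp_mul_left (a := 0) (b := 1)
    (f := fun u => Real.exp (t * u) - 1) y
  simp only [mul_zero, mul_one] at this
  rw [← this, expMean]
  simp only [mul_assoc]

theorem integral_exp_mul (t b : ℝ) :
    ∫ s in (0 : ℝ)..b, Real.exp (t * s) = b * (1 + expMean (t * b)) := by
  rw [mul_add, mul_expMean, intervalIntegral.integral_sub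
    (Continuous.intervalIntegrable (by fun_prop) _ _) intervalIntegrable_const]
  simp

theorem hasDerivAt_expMean_mul (t : ℝ) {y : ℝ} (hy : y ≠ 0) :
    HasDerivAt (fun y => expMean (t * y)) ((Real.exp (t * y) - 1 - expMean (t * y)) / y) y := by
  have h1 : HasDerivAt (fun y => ∫ u in (0 : ℝ)..y, (Real.exp (t * u) - 1))
      (Real.exp (t * y) - 1) y :=
    intervalIntegral.integral_hasDerivAt_right
      (Continuous.intervalIntegrable (by fun_prop) _ _)
      (Continuous.stronglyMeasurableAtFilter (by fun_prop) _ _)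
      (Continuous.continuousAt (by fun_prop))
  have h2 := h1.div (hasDerivAt_id y) hy
  have h3 : (fun y => (∫ u in (0 : ℝ)..y, (Real.exp (t * u) - 1)) / id y) =ᶠ[𝓝 y]
      fun y => expMean (t * y) := by
    filter_upwards [isOpen_ne.mem_nhds hy] with z hz
    rw [← mul_expMean, id, mul_div_cancel_left₀ _ hz]
  refine (h2.congr_of_eventuallyEq h3.symm).congr_deriv ?_
  rw [← mul_expMean, id]
  field_simp

theorem continuous_expMean : Continuous expMean := by
  unfold expMean
  exact intervalIntegral.continuous_parametric_intervalIntegral_of_continuous' (by fun_prop) _ _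

theorem expMean_zero : expMean 0 = 0 := by simp [expMean]

theorem abs_exp_mul_sub_one_div_le (t : ℝ) {u : ℝ} (hu : u ∈ Set.Icc (0 : ℝ) 1) :
    |(Real.exp (t * u) - 1) / u| ≤ |t| * Real.exp |t| := by
  rcases hu.1.eq_or_lt with rfl | h0
  · simp; positivity
  · rw [abs_div, abs_of_pos h0, div_le_iff₀ h0]
    refine (abs_exp_sub_one_le_mul_exp _).trans ?_
    rw [abs_mul, abs_of_pos h0]
    have h1 : |t| * u ≤ |t| := mul_le_of_le_one_right (abs_nonneg t) hu.2
    calc |t| * u * Real.exp (|t| * u) ≤ |t| * u * Real.exp |t| := by gcongr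
      _ = _ := by ring

theorem intervalIntegrable_exp_mul_sub_one_div (t : ℝ) {y : ℝ} (hy : y ∈ Set.Icc (0 : ℝ) 1) :
    IntervalIntegrable (fun u => (Real.exp (t * u) - 1) / u) volume 0 y := by
  refine (intervalIntegrable_const (c := |t| * Real.exp |t|)).mono_fun'
    (Measurable.aestronglyMeasurable (by fun_prop)) ?_
  refine (ae_restrict_iff' measurableSet_uIoc).2 (ae_of_all _ fun u hu => ?_)
  rw [Set.uIoc_of_le hy.1] at hu
  exact abs_exp_mul_sub_one_div_le t ⟨hu.1.le, hu.2.trans hy.2⟩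

/-- With `E y = ∫_0^y (e^(tu) - 1) / u du`, the function `E y - expMean (t y)` has derivative
`expMean (t y) / y` and equals the integral in `phi` at `y = 1`; then substitute `y = x ^ α`. -/
theorem phi_eq {α : ℝ} (hα : 0 < α) (t : ℝ) :
    phi α t = ∫ x in (0 : ℝ)..1, (α + 1) / x * expMean (t * x ^ α) := by
  let E (y : ℝ) : ℝ := ∫ u in (0 : ℝ)..y, (Real.exp (t * u) - 1) / u
  have hE1 : E 1 - expMean t =
      ∫ u in (0 : ℝ)..1, (Real.exp (t * u) - 1) * ((1 - u) / u) := by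
    simp only [E, expMean]
    rw [← intervalIntegral.integral_sub
      (intervalIntegrable_exp_mul_sub_one_div t ⟨zero_le_one, le_rfl⟩)
      (Continuous.intervalIntegrable (by fun_prop) _ _)]
    refine intervalIntegral.integral_congr_ae (ae_of_all _ fun u hu => ?_)
    rw [Set.uIoc_of_le zero_le_one] at hu
    have := hu.1.ne'
    field_simp
  have hEcont : ContinuousOn E (Set.Icc 0 1) := by
    have := intervalIntegral.continuousOn_primitive_interval' (a := (0 : ℝ)) (b₁ := 0) (b₂ := 1)
      (intervalIntegrable_exp_mul_sub_one_div t (y := 1) ⟨zero_le_one, le_rfl⟩) (by simp)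
    rwa [Set.uIcc_of_le zero_le_one] at this
  have hEderiv (y : ℝ) (hy : y ∈ Set.Ioo (0 : ℝ) 1) :
      HasDerivAt E ((Real.exp (t * y) - 1) / y) y := by
    have hc : ContinuousAt (fun u => (Real.exp (t * u) - 1) / u) y :=
      ContinuousAt.div (by fun_prop) continuousAt_id hy.1.ne'
    exact intervalIntegral.integral_hasDerivAt_right
      (intervalIntegrable_exp_mul_sub_one_div t ⟨hy.1.le, hy.2.le⟩)
      (Measurable.stronglyMeasurable (by fun_prop)).stronglyMeasurableAtFilter hc
  have hmaps : Set.MapsTo (fun x : ℝ => x ^ α) (Set.Icc 0 1) (Set.Icc 0 1) := fun x hx =>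
    ⟨Real.rpow_nonneg hx.1 _, Real.rpow_le_one hx.1 hx.2 hα.le⟩
  have hrc : Continuous fun x : ℝ => x ^ α := Real.continuous_rpow_const hα.le
  let V (x : ℝ) : ℝ := (α + 1) / α * (E (x ^ α) - expMean (t * x ^ α))
  have hV : ContinuousOn V (Set.Icc 0 1) :=
    continuousOn_const.mul ((hEcont.comp hrc.continuousOn hmaps).sub
      (continuous_expMean.comp (continuous_const.mul hrc)).continuousOn)
  have hVd (x : ℝ) (hx : x ∈ Set.Ioo (0 : ℝ) 1) :
      HasDerivAt V ((α + 1) / x * expMean (t * x ^ α)) x := by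
    have hy : x ^ α ∈ Set.Ioo (0 : ℝ) 1 :=
      ⟨Real.rpow_pos_of_pos hx.1 _, Real.rpow_lt_one hx.1.le hx.2 hα⟩
    have hr : HasDerivAt (fun x : ℝ => x ^ α) (α * x ^ (α - 1)) x :=
      Real.hasDerivAt_rpow_const (Or.inl hx.1.ne')
    have h1 := (((hEderiv _ hy).sub (hasDerivAt_expMean_mul t hy.1.ne')).comp x hr).const_mul
      ((α + 1) / α)
    refine h1.congr_deriv ?_
    rw [Real.rpow_sub_one hx.1.ne']
    have := hx.1.ne'
    have := hy.1.ne'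
    field_simp
    ring
  have hbound : ∀ x ∈ Set.Ioc (0 : ℝ) 1, ‖(α + 1) / x * expMean (t * x ^ α)‖ ≤
      (α + 1) * (|t| * Real.exp |t|) * x ^ (α - 1) := by
    intro x hx
    have hy := hmaps ⟨hx.1.le, hx.2⟩
    have h1 : |t * x ^ α| ≤ |t| := by
      rw [abs_mul, abs_of_nonneg hy.1]
      exact mul_le_of_le_one_right (abs_nonneg t) hy.2
    rw [norm_mul, Real.norm_of_nonneg (div_nonneg (by linarith) hx.1.le), Real.norm_eq_abs]
    calc (α + 1) / x * |expMean (t * x ^ α)|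
        ≤ (α + 1) / x * (|t * x ^ α| * Real.exp |t|) := by
          have := hx.1
          refine mul_le_mul_of_nonneg_left ?_ (by positivity)
          refine (abs_expMean_le _).trans ?_
          gcongr
      _ = _ := by
          rw [abs_mul, abs_of_nonneg hy.1, Real.rpow_sub_one hx.1.ne']
          ring
  have hint : IntervalIntegrable (fun x : ℝ => (α + 1) / x * expMean (t * x ^ α)) volume 0 1 := by
    refine ((intervalIntegral.intervalIntegrable_rpow' (r := α - 1) (by linarith)).const_mul
      ((α + 1) * (|t| * Real.exp |t|))).mono_fun' ?_ ?_
    · refine (Measurable.mul (by fun_prop) ?_).aestronglyMeasurable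
      exact (continuous_expMean.comp (continuous_const.mul hrc)).measurable
    · refine (ae_restrict_iff' measurableSet_uIoc).2 (ae_of_all _ fun x hx => ?_)
      rw [Set.uIoc_of_le zero_le_one] at hx
      exact hbound x hx
  rw [intervalIntegral.integral_eq_sub_of_hasDerivAt_of_le zero_le_one hV hVd hint]
  simp only [V, E, Real.one_rpow, Real.zero_rpow hα.ne', mul_one, mul_zero,
    intervalIntegral.integral_same, expMean_zero, sub_zero]
  rw [phi, ← hE1]

theorem tendsto_prod_one_add_mul_expMean {a : ℕ → ℝ} {α : ℝ} (hreg : RegularlyVarying a α)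
    (hα : 0 < α) (ha : ∀ n, 1 ≤ n → 0 < a n) (t : ℝ) :
    Tendsto (fun n : ℕ => ∏ k ∈ Finset.Icc 1 n,
      (1 + a k / (∑ j ∈ Finset.Icc 1 k, a j) * expMean (t * (a k / a n)))) atTop
      (𝓝 (Real.exp (phi α t))) := by
  set A : ℕ → ℝ := fun k => ∑ j ∈ Finset.Icc 1 k, a j with hA
  have hakA (k : ℕ) (hk : 1 ≤ k) : a k ≤ A k :=
    Finset.single_le_sum (f := a) (fun j hj => (ha j (Finset.mem_Icc.1 hj).1).le)
      (Finset.mem_Icc.2 ⟨hk, le_rfl⟩)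
  have hA0 (k : ℕ) (hk : 1 ≤ k) : 0 < A k := (ha k hk).trans_le (hakA k hk)
  have hp0 (k : ℕ) (hk : 1 ≤ k) : 0 ≤ a k / A k := (div_pos (ha k hk) (hA0 k hk)).le
  have hp1 (k : ℕ) (hk : 1 ≤ k) : a k / A k ≤ 1 := (div_le_one (hA0 k hk)).2 (hakA k hk)
  have hkp : Tendsto (fun k : ℕ => (k : ℝ) * (a k / A k)) atTop (𝓝 (α + 1)) := by
    have := (hreg.tendsto_sum_div hα ha).inv₀ (by positivity)
    simp only [one_div, inv_inv, inv_div] at this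
    refine this.congr fun k => ?_
    simp only [hA]
    ring
  obtain ⟨C₂, hC₂⟩ := hkp.bddAbove_range
  have hC₂' (k : ℕ) : (k : ℝ) * (a k / A k) ≤ C₂ := hC₂ ⟨k, rfl⟩
  have hC₂0 : 0 ≤ C₂ := le_trans (by simp) (hC₂' 0)
  -- The Potter bound needs `β < α`, the Riemann sum lemma `β ≤ 1`.
  set β := min (α / 2) 1 with hβdef
  have hβ : 0 < β := by positivity
  have hβα : β < α := (min_le_left _ _).trans_lt (by linarith)
  obtain ⟨C, hC, hCa⟩ := hreg.exists_le_mul_rpow_mul hα ha hβ hβα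
  set S := |t| * C with hS
  let q (n k : ℕ) : ℝ := a k / A k * expMean (t * (a k / a n))
  have hs (n k : ℕ) (hk : 1 ≤ k) (hkn : k ≤ n) :
      |t * (a k / a n)| ≤ S * ((k : ℝ) / n) ^ β := by
    have han := ha n (hk.trans hkn)
    rw [abs_mul, abs_of_pos (div_pos (ha k hk) han), hS, mul_assoc]
    refine mul_le_mul_of_nonneg_left ?_ (abs_nonneg t)
    rw [div_le_iff₀ han]
    exact hCa k n hk hkn
  have hsS (n k : ℕ) (hk : 1 ≤ k) (hkn : k ≤ n) : |t * (a k / a n)| ≤ S := by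
    refine (hs n k hk hkn).trans (mul_le_of_le_one_right (by positivity) ?_)
    have hn0 : (0 : ℝ) < n := by exact_mod_cast hk.trans hkn
    exact Real.rpow_le_one (by positivity) ((div_le_one hn0).2 (by exact_mod_cast hkn)) hβ.le
  have hlow (n k : ℕ) (hk : 1 ≤ k) (hkn : k ≤ n) : Real.exp (-S) ≤ 1 + q n k :=
    (Real.exp_le_exp.2 (neg_le_neg (hsS n k hk hkn))).trans
      (exp_neg_abs_le_one_add_mul_expMean (hp0 k hk) (hp1 k hk) _)
  -- Away from `0` the logarithm is Lipschitz, so a bound on `q` dominates the summands.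
  have hlogle (y : ℝ) (hy : Real.exp (-S) ≤ 1 + y) :
      |Real.log (1 + y)| ≤ Real.exp S * |y| := by
    have hy0 : 0 < 1 + y := (Real.exp_pos _).trans_le hy
    have hS1 : 1 ≤ Real.exp S := Real.one_le_exp (by positivity)
    have hinv : (1 + y)⁻¹ ≤ Real.exp S := by
      rw [← neg_neg S, Real.exp_neg (-S)]
      exact inv_anti₀ (Real.exp_pos _) hy
    have hyl : |y| ≤ Real.exp S * |y| := le_mul_of_one_le_left (abs_nonneg y) hS1
    rw [abs_le]
    constructor
    · have h1 := Real.one_sub_inv_le_log_of_pos hy0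
      have h2 : 1 - (1 + y)⁻¹ = (1 + y)⁻¹ * y := by field_simp; ring
      have h3 : -(Real.exp S * |y|) ≤ (1 + y)⁻¹ * y := by
        have h4 : |(1 + y)⁻¹ * y| ≤ Real.exp S * |y| := by
          rw [abs_mul, abs_of_pos (inv_pos.2 hy0)]
          gcongr
        linarith [neg_abs_le ((1 + y)⁻¹ * y)]
      linarith
    · have h1 := Real.log_le_sub_one_of_pos hy0
      linarith [le_abs_self y]
  have hqdom (n k : ℕ) (hk : 1 ≤ k) (hkn : k ≤ n) :
      |q n k| ≤ C₂ * (S * Real.exp S) * ((k : ℝ) / n) ^ (β - 1) / n := by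
    have hn0 : (0 : ℝ) < n := by exact_mod_cast hk.trans hkn
    have hk0 : (0 : ℝ) < k := by exact_mod_cast hk
    have h1 : a k / A k ≤ C₂ / k := by
      rw [le_div_iff₀ hk0, mul_comm]
      exact hC₂' k
    calc |q n k| = a k / A k * |expMean (t * (a k / a n))| := by
          rw [abs_mul, abs_of_nonneg (hp0 k hk)]
      _ ≤ C₂ / k * (S * ((k : ℝ) / n) ^ β * Real.exp S) := by
          have h2 := abs_expMean_le (t * (a k / a n))
          have h3 : |t * (a k / a n)| * Real.exp |t * (a k / a n)| ≤
              S * ((k : ℝ) / n) ^ β * Real.exp S :=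
            mul_le_mul (hs n k hk hkn) (Real.exp_le_exp.2 (hsS n k hk hkn)) (Real.exp_pos _).le
              (by positivity)
          exact mul_le_mul h1 (h2.trans h3) (abs_nonneg _) (by positivity)
      _ = _ := by
          rw [Real.rpow_sub_one (by positivity)]
          field_simp
  have hsum : Tendsto (fun n : ℕ => ∑ k ∈ Finset.Icc 1 n, Real.log (1 + q n k)) atTop
      (𝓝 (phi α t)) := by
    rw [phi_eq hα]
    refine tendsto_sum_Icc_of_dominated (C := Real.exp S * (C₂ * (S * Real.exp S))) hβ
      (min_le_right _ _) (fun n k hk hkn => ?_) (fun x hx => ?_)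
    · refine (hlogle _ (hlow n k hk hkn)).trans ?_
      refine (mul_le_mul_of_nonneg_left (hqdom n k hk hkn) (Real.exp_pos S).le).trans
        (le_of_eq ?_)
      ring
    · refine Real.tendsto_nat_mul_log_one_add_of_tendsto (g := fun n => q n ⌊x * (n : ℝ)⌋₊) ?_
      have hfl : Tendsto (fun n : ℕ => ⌊x * (n : ℝ)⌋₊) atTop atTop :=
        tendsto_nat_floor_atTop.comp (tendsto_natCast_atTop_atTop.const_mul_atTop hx.1)
      have hratio : Tendsto (fun n : ℕ => ((⌊x * (n : ℝ)⌋₊ : ℝ) / n)⁻¹) atTop (𝓝 x⁻¹) :=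
        ((tendsto_nat_floor_mul_div_atTop hx.1.le).comp tendsto_natCast_atTop_atTop).inv₀ hx.1.ne'
      have hg : Tendsto (fun n : ℕ => expMean (t * (a ⌊x * (n : ℝ)⌋₊ / a n))) atTop
          (𝓝 (expMean (t * x ^ α))) :=
        (continuous_expMean.tendsto _).comp ((hreg x hx.1).const_mul t)
      have hlim := (hratio.mul (hkp.comp hfl)).mul hg
      rw [show x⁻¹ * (α + 1) = (α + 1) / x by ring] at hlim
      refine hlim.congr' ?_
      filter_upwards [eventually_gt_atTop 0, hfl.eventually_gt_atTop 0] with n hn hm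
      have hn0 : (n : ℝ) ≠ 0 := by exact_mod_cast hn.ne'
      have hm0 : (⌊x * (n : ℝ)⌋₊ : ℝ) ≠ 0 := by exact_mod_cast hm.ne'
      simp only [Function.comp, q]
      field_simp
  have hexp := (Real.continuous_exp.tendsto _).comp hsum
  refine hexp.congr fun n => ?_
  rw [Function.comp, Real.exp_sum]
  refine Finset.prod_congr rfl fun k hk => ?_
  rw [Finset.mem_Icc] at hk
  exact Real.exp_log ((Real.exp_pos _).trans_le (hlow n k hk.1 hk.2))

theorem one_add_mul_expMean_pos {a : ℕ → ℝ} (ha : ∀ n, 1 ≤ n → 0 < a n) (t : ℝ) {k : ℕ}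
    (hk : 1 ≤ k) :
    0 < 1 + a k / (∑ j ∈ Finset.Icc 1 k, a j) * expMean t := by
  have h1 : a k ≤ ∑ j ∈ Finset.Icc 1 k, a j :=
    Finset.single_le_sum (f := a) (fun j hj => (ha j (Finset.mem_Icc.1 hj).1).le)
      (Finset.mem_Icc.2 ⟨hk, le_rfl⟩)
  have h0 := (ha k hk).trans_le h1
  exact (Real.exp_pos _).trans_le (exp_neg_abs_le_one_add_mul_expMean
    (div_pos (ha k hk) h0).le ((div_le_one h0).2 h1) t)

/-! ### Heights in the tree and their measurability. -/

section TreeDist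

theorem treeDist_congr {g g' : ℕ → ℕ × ℝ} {n : ℕ} (h : ∀ k ∈ Finset.Ico 1 n, g k = g' k)
    (p q : ℕ × ℝ) : treeDist g n p q = treeDist g' n p q := by
  induction n generalizing p q with
  | zero => rfl
  | succ n ih =>
    have hn (p q : ℕ × ℝ) : treeDist g n p q = treeDist g' n p q :=
      ih (fun k hk => h k (by simp only [Finset.mem_Ico] at hk ⊢; omega)) p q
    rcases Nat.eq_zero_or_pos n with rfl | hpos
    · simp [treeDist]
    · simp only [treeDist, hn, h n (by simp only [Finset.mem_Ico]; omega)]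

theorem treeDist_succ_root_of_le (g : ℕ → ℕ × ℝ) {n : ℕ} {p : ℕ × ℝ} (hn : 1 ≤ n) (hp : p.1 ≤ n) :
    treeDist g (n + 1) p root = treeDist g n p root := by
  simp [treeDist, root, hp, hn]

theorem treeDist_root_of_le (g : ℕ → ℕ × ℝ) {m n : ℕ} {p : ℕ × ℝ} (hm : 1 ≤ m) (hp : p.1 ≤ m)
    (hmn : m ≤ n) : treeDist g n p root = treeDist g m p root := by
  induction n, hmn using Nat.le_induction with
  | base => rfl
  | succ n hmn ih =>
    rw [treeDist_succ_root_of_le g (hm.trans hmn) (hp.trans hmn), ih]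

/-- Holds for `n = 0` too, because `treeDist g 0` is `0`; this lets the recursion start from the
empty tree. -/
theorem treeDist_succ_root (g : ℕ → ℕ × ℝ) (n : ℕ) {s : ℝ} (hs : 0 ≤ s) :
    treeDist g (n + 1) (n + 1, s) root = s + treeDist g n (g n) root := by
  rcases Nat.eq_zero_or_pos n with rfl | hn
  · simp [treeDist, root, abs_of_nonneg hs]
  · simp [treeDist, root, Nat.one_le_iff_ne_zero.2 hn.ne']

theorem measurable_treeDist (n : ℕ) :
    Measurable fun x : (ℕ → ℕ × ℝ) × (ℕ × ℝ) × (ℕ × ℝ) => treeDist x.1 n x.2.1 x.2.2 := by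
  induction n with
  | zero => exact measurable_const
  | succ n ih =>
    simp only [treeDist]
    have hg : Measurable fun x : (ℕ → ℕ × ℝ) × (ℕ × ℝ) × (ℕ × ℝ) => x.1 n :=
      (measurable_pi_apply n).comp measurable_fst
    have h1 : MeasurableSet {x : (ℕ → ℕ × ℝ) × (ℕ × ℝ) × (ℕ × ℝ) | x.2.1.1 ≤ n} :=
      measurableSet_le (by fun_prop) measurable_const
    have h2 : MeasurableSet {x : (ℕ → ℕ × ℝ) × (ℕ × ℝ) × (ℕ × ℝ) | x.2.2.1 ≤ n} :=
      measurableSet_le (by fun_prop) measurable_const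
    refine Measurable.ite h1 (Measurable.ite h2 ih (Measurable.add ?_ (by fun_prop)))
      (Measurable.ite h2 (Measurable.add (by fun_prop) ?_) (by fun_prop))
    · exact ih.comp (measurable_fst.prodMk ((measurable_fst.comp measurable_snd).prodMk hg))
    · exact ih.comp (measurable_fst.prodMk (hg.prodMk (measurable_snd.comp measurable_snd)))

/-- The sequence of gluing points with prescribed values at `1, …, n - 1`. -/
def extend (n : ℕ) (v : Finset.Ico 1 n → ℕ × ℝ) (k : ℕ) : ℕ × ℝ :=
  if h : k ∈ Finset.Ico 1 n then v ⟨k, h⟩ else (0, 0)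

theorem measurable_extend (n : ℕ) : Measurable (extend n) := by
  refine measurable_pi_lambda _ fun k => ?_
  by_cases h : k ∈ Finset.Ico 1 n
  · simp only [extend, h, dite_true]
    exact measurable_pi_apply _
  · simp only [extend, h, dite_false]
    exact measurable_const

theorem treeDist_extend (g : ℕ → ℕ × ℝ) (n : ℕ) (p q : ℕ × ℝ) :
    treeDist (extend n fun k => g k) n p q = treeDist g n p q :=
  treeDist_congr (fun k hk => by simp [extend, Finset.mem_Ico.1 hk]) p q

theorem measurable_treeDist_extend_root (n : ℕ) :
    Measurable fun x : (ℕ × ℝ) × (Finset.Ico 1 n → ℕ × ℝ) =>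
      treeDist (extend n x.2) n x.1 root :=
  (measurable_treeDist n).comp
    (((measurable_extend n).comp measurable_snd).prodMk (measurable_fst.prodMk measurable_const))

end TreeDist

/-! ### Integration against the length measure. -/

section LengthMeasure

theorem measurableSet_tree (a : ℕ → ℝ) (n : ℕ) : MeasurableSet (tree a n) := by
  have ha : Measurable fun p : ℕ × ℝ => a p.1 := (measurable_from_nat (f := a)).comp measurable_fst
  have h : tree a n = ({p | 1 ≤ p.1} ∩ {p | p.1 ≤ n}) ∩ ({p | 0 ≤ p.2} ∩ {p | p.2 ≤ a p.1}) := by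
    ext p
    simp [tree, and_assoc]
  rw [h]
  exact ((measurableSet_le measurable_const measurable_fst).inter
    (measurableSet_le measurable_fst measurable_const)).inter
    ((measurableSet_le measurable_const measurable_snd).inter (measurableSet_le measurable_snd ha))

theorem setLIntegral_tree (a : ℕ → ℝ) (n : ℕ) {f : ℕ × ℝ → ENNReal} (hf : Measurable f) :
    ∫⁻ p in tree a n, f p ∂lengthMeasure =
      ∑ k ∈ Finset.Icc 1 n, ∫⁻ s in Set.Icc 0 (a k), f (k, s) := by
  rw [← lintegral_indicator (measurableSet_tree a n), lengthMeasure,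
    lintegral_prod _ (hf.indicator (measurableSet_tree a n)).aemeasurable, lintegral_count,
    tsum_eq_sum (s := Finset.Icc 1 n)]
  · refine Finset.sum_congr rfl fun k hk => ?_
    rw [← lintegral_indicator measurableSet_Icc]
    refine lintegral_congr fun s => ?_
    rw [Finset.mem_Icc] at hk
    simp [Set.indicator, tree, hk]
  · intro k hk
    rw [Finset.mem_Icc] at hk
    refine (lintegral_congr fun s => ?_).trans lintegral_zero
    refine Set.indicator_of_notMem (fun h => hk ⟨h.1, h.2.1⟩) _

theorem lengthMeasure_tree {a : ℕ → ℝ} (ha : ∀ n, 1 ≤ n → 0 < a n) (n : ℕ) :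
    lengthMeasure (tree a n) = ENNReal.ofReal (∑ k ∈ Finset.Icc 1 n, a k) := by
  have h := setLIntegral_tree a n (f := fun _ => 1) measurable_const
  rw [setLIntegral_one] at h
  rw [h, ENNReal.ofReal_sum_of_nonneg fun k hk => (ha k (Finset.mem_Icc.1 hk).1).le]
  simp

end LengthMeasure

/-! ### Moment generating function of the height of the gluing point. -/

namespace IsGluing

variable {Ω : Type*} [MeasurableSpace Ω] {P : Measure Ω} {a : ℕ → ℝ} {X : ℕ → Ω → ℕ × ℝ}

theorem measurable_restrict (hX : IsGluing P a X) (n : ℕ) :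
    Measurable fun ω (k : Finset.Ico 1 n) => X k ω :=
  measurable_pi_lambda _ fun k => hX.measurable k (Finset.mem_Ico.1 k.2).1

theorem measurable_treeDist_root (hX : IsGluing P a X) (n : ℕ) {Y : Ω → ℕ × ℝ}
    (hY : Measurable Y) :
    Measurable fun ω => treeDist (fun k => X k ω) n (Y ω) root := by
  have := (measurable_treeDist_extend_root n).comp (hY.prodMk (hX.measurable_restrict n))
  have heq : (fun ω => treeDist (fun k => X k ω) n (Y ω) root) =
      (fun x : (ℕ × ℝ) × (Finset.Ico 1 n → ℕ × ℝ) => treeDist (extend n x.2) n x.1 root) ∘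
        fun ω => (Y ω, fun k : Finset.Ico 1 n => X k ω) :=
    funext fun ω => (treeDist_extend (fun k => X k ω) n (Y ω) root).symm
  rwa [heq]

theorem measurable_treeDist_gluing (hX : IsGluing P a X) (n : ℕ) :
    Measurable fun ω => treeDist (fun k => X k ω) n (X n ω) root := by
  rcases Nat.eq_zero_or_pos n with rfl | hn
  · exact measurable_const
  · exact hX.measurable_treeDist_root n (hX.measurable n hn)

theorem indepFun_restrict (hX : IsGluing P a X) (n : ℕ) (hn : 1 ≤ n) :
    IndepFun (X n) (fun ω (k : Finset.Ico 1 n) => X k ω) P := by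
  have h := hX.indep.indepFun_finset {n - 1} (Finset.range (n - 1)) (by simp)
    (fun i => hX.measurable (i + 1) (by omega))
  let φ (v : ({n - 1} : Finset ℕ) → ℕ × ℝ) : ℕ × ℝ := v ⟨n - 1, by simp⟩
  let ψ (v : Finset.range (n - 1) → ℕ × ℝ) (k : Finset.Ico 1 n) : ℕ × ℝ := v ⟨k - 1, by
    have := Finset.mem_Ico.1 k.2
    simp only [Finset.mem_range]
    omega⟩
  have hφ : Measurable φ := measurable_pi_apply _
  have hψ : Measurable ψ := measurable_pi_lambda _ fun k => measurable_pi_apply _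
  have h' := h.comp hφ hψ
  have e1 : (φ ∘ fun ω (i : ({n - 1} : Finset ℕ)) => X (i + 1) ω) = X n := by
    funext ω
    simp only [Function.comp, φ]
    rw [Nat.sub_add_cancel hn]
  have e2 : (ψ ∘ fun ω (i : Finset.range (n - 1)) => X (i + 1) ω) =
      fun ω (k : Finset.Ico 1 n) => X k ω := by
    funext ω k
    simp only [Function.comp, ψ]
    rw [Nat.sub_add_cancel (Finset.mem_Ico.1 k.2).1]
  rwa [e1, e2] at h'

variable [IsProbabilityMeasure P]

/-- Averaging over the uniform gluing point of `T_n`. -/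
theorem lintegral_treeDist (hX : IsGluing P a X) (ha : ∀ n, 1 ≤ n → 0 < a n) (n : ℕ) (hn : 1 ≤ n)
    {f : ℝ → ENNReal} (hf : Measurable f) :
    ENNReal.ofReal (∑ k ∈ Finset.Icc 1 n, a k) *
        ∫⁻ ω, f (treeDist (fun k => X k ω) n (X n ω) root) ∂P =
      ∑ k ∈ Finset.Icc 1 n, ∫⁻ s in Set.Icc 0 (a k),
        ∫⁻ ω, f (treeDist (fun k => X k ω) n (k, s) root) ∂P := by
  let Y : Ω → Finset.Ico 1 n → ℕ × ℝ := fun ω k => X k ω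
  have hY : Measurable Y := hX.measurable_restrict n
  have hF : Measurable fun x : (ℕ × ℝ) × (Finset.Ico 1 n → ℕ × ℝ) =>
      f (treeDist (extend n x.2) n x.1 root) := hf.comp (measurable_treeDist_extend_root n)
  have hext (ω : Ω) (p : ℕ × ℝ) :
      treeDist (extend n (Y ω)) n p root = treeDist (fun k => X k ω) n p root :=
    treeDist_extend (fun k => X k ω) n p root
  have hin (p : ℕ × ℝ) : ∫⁻ v, f (treeDist (extend n v) n p root) ∂(P.map Y) =
      ∫⁻ ω, f (treeDist (fun k => X k ω) n p root) ∂P := by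
    rw [lintegral_map (f := fun v => f (treeDist (extend n v) n p root))
      (hF.comp measurable_prodMk_left) hY]
    simp only [hext]
  have hprod := (indepFun_iff_map_prod_eq_prod_map_map (hX.measurable n hn).aemeasurable
    hY.aemeasurable).1 (hX.indepFun_restrict n hn)
  have : IsProbabilityMeasure (P.map Y) := Measure.isProbabilityMeasure_map hY.aemeasurable
  -- `T_n` depends only on `X 1, …, X (n - 1)`, which are independent of `X n`: by Fubini the point
  -- can be frozen while the tree is averaged.
  have h1 : ∫⁻ ω, f (treeDist (fun k => X k ω) n (X n ω) root) ∂P =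
      ∫⁻ p, ∫⁻ ω, f (treeDist (fun k => X k ω) n p root) ∂P ∂(P.map (X n)) := by
    simp only [← hin]
    rw [← lintegral_prod _ hF.aemeasurable, ← hprod,
      lintegral_map hF ((hX.measurable n hn).prodMk hY)]
    refine lintegral_congr fun ω => ?_
    rw [← hext]
  have hmeas : Measurable fun p => ∫⁻ ω, f (treeDist (fun k => X k ω) n p root) ∂P := by
    simp only [← hin]
    exact hF.lintegral_prod_right'
  have hlen := lengthMeasure_tree ha n
  have hpos : 0 < ∑ k ∈ Finset.Icc 1 n, a k :=
    Finset.sum_pos (fun k hk => ha k (Finset.mem_Icc.1 hk).1) ⟨1, by simp [hn]⟩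
  rw [h1, hX.uniform n hn, ProbabilityTheory.cond, lintegral_smul_measure, hlen, smul_eq_mul,
    ← mul_assoc, ENNReal.mul_inv_cancel (by simpa using hpos) ENNReal.ofReal_ne_top, one_mul,
    setLIntegral_tree a n hmeas]

/-- Split the uniform point of `T_{n+1}` according to its segment. Old segments reproduce the
average over `T_n`; on `b_{n+1}` the height is `s` plus the height of `X n`. Both parts contain the
same expectation, so the recursion closes. -/
theorem lintegral_exp_treeDist_succ (hX : IsGluing P a X) (ha : ∀ n, 1 ≤ n → 0 < a n) (t : ℝ)
    (n : ℕ) :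
    ENNReal.ofReal (∑ k ∈ Finset.Icc 1 (n + 1), a k) *
        ∫⁻ ω, ENNReal.ofReal
          (Real.exp (t * treeDist (fun k => X k ω) (n + 1) (X (n + 1) ω) root)) ∂P =
      (ENNReal.ofReal (∑ k ∈ Finset.Icc 1 n, a k) +
        ∫⁻ s in Set.Icc 0 (a (n + 1)), ENNReal.ofReal (Real.exp (t * s))) *
        ∫⁻ ω, ENNReal.ofReal (Real.exp (t * treeDist (fun k => X k ω) n (X n ω) root)) ∂P := by
  have hf : Measurable fun x : ℝ => ENNReal.ofReal (Real.exp (t * x)) := by fun_prop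
  rw [hX.lintegral_treeDist ha (n + 1) (by omega) hf, Finset.sum_Icc_succ_top (by omega), add_mul]
  congr 1
  · rcases Nat.eq_zero_or_pos n with rfl | hn
    · simp
    · rw [hX.lintegral_treeDist ha n hn hf]
      refine Finset.sum_congr rfl fun k hk => ?_
      rw [Finset.mem_Icc] at hk
      simp only [treeDist_succ_root_of_le _ hn (p := (k, _)) hk.2]
  · rw [← lintegral_mul_const _ hf]
    refine setLIntegral_congr_fun measurableSet_Icc fun s hs => ?_
    refine Eq.trans ?_ (lintegral_const_mul _ (hf.comp (hX.measurable_treeDist_gluing n)))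
    refine lintegral_congr fun ω => ?_
    rw [treeDist_succ_root _ _ hs.1, mul_add, Real.exp_add,
      ENNReal.ofReal_mul (Real.exp_pos _).le]

theorem lintegral_exp_treeDist (hX : IsGluing P a X) (ha : ∀ n, 1 ≤ n → 0 < a n) (t : ℝ) (n : ℕ) :
    ∫⁻ ω, ENNReal.ofReal (Real.exp (t * treeDist (fun k => X k ω) n (X n ω) root)) ∂P =
      ENNReal.ofReal (∏ k ∈ Finset.Icc 1 n,
        (1 + a k / (∑ j ∈ Finset.Icc 1 k, a j) * expMean (t * a k))) := by
  induction n with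
  | zero => simp [treeDist]
  | succ n ih =>
    have h := hX.lintegral_exp_treeDist_succ ha t n
    rw [ih] at h
    have han := ha (n + 1) (by omega)
    have hA : 0 ≤ ∑ k ∈ Finset.Icc 1 n, a k :=
      Finset.sum_nonneg fun k hk => (ha k (Finset.mem_Icc.1 hk).1).le
    have hA' : ∑ k ∈ Finset.Icc 1 (n + 1), a k = ∑ k ∈ Finset.Icc 1 n, a k + a (n + 1) :=
      Finset.sum_Icc_succ_top (by omega) _
    have hA1 : 0 < ∑ k ∈ Finset.Icc 1 (n + 1), a k := by rw [hA']; linarith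
    have hseg : ∫⁻ s in Set.Icc 0 (a (n + 1)), ENNReal.ofReal (Real.exp (t * s)) =
        ENNReal.ofReal (a (n + 1) * (1 + expMean (t * a (n + 1)))) := by
      rw [← integral_exp_mul, intervalIntegral.integral_of_le han.le,
        ← integral_Icc_eq_integral_Ioc, ofReal_integral_eq_lintegral_ofReal]
      · exact (Continuous.continuousOn (by fun_prop)).integrableOn_Icc
      · exact ae_of_all _ fun s => (Real.exp_pos _).le
    have hg : 0 ≤ 1 + expMean (t * a (n + 1)) :=
      (Real.exp_pos _).le.trans (exp_neg_abs_le_one_add_expMean _)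
    have hprod : 0 ≤ ∏ k ∈ Finset.Icc 1 n,
        (1 + a k / (∑ j ∈ Finset.Icc 1 k, a j) * expMean (t * a k)) :=
      Finset.prod_nonneg fun k hk => (one_add_mul_expMean_pos ha _ (Finset.mem_Icc.1 hk).1).le
    rw [hseg, ← ENNReal.ofReal_add hA (by positivity), ← ENNReal.ofReal_mul (by positivity)] at h
    rw [← ENNReal.mul_right_inj (a := ENNReal.ofReal (∑ k ∈ Finset.Icc 1 (n + 1), a k))
      (by simpa using hA1) ENNReal.ofReal_ne_top, h, ← ENNReal.ofReal_mul hA1.le]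
    congr 1
    rw [Finset.prod_Icc_succ_top (by omega)]
    have := hA1.ne'
    field_simp
    rw [hA']
    ring

theorem integrable_exp_treeDist (hX : IsGluing P a X) (ha : ∀ n, 1 ≤ n → 0 < a n) (t : ℝ) (n : ℕ) :
    Integrable (fun ω => Real.exp (t * treeDist (fun k => X k ω) n (X n ω) root)) P := by
  refine ⟨(Real.measurable_exp.comp
    ((hX.measurable_treeDist_gluing n).const_mul t)).aestronglyMeasurable, ?_⟩
  rw [hasFiniteIntegral_iff_ofReal (ae_of_all _ fun ω => (Real.exp_pos _).le),
    hX.lintegral_exp_treeDist ha t n]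
  exact ENNReal.ofReal_lt_top

theorem integral_exp_treeDist (hX : IsGluing P a X) (ha : ∀ n, 1 ≤ n → 0 < a n) (t : ℝ) (n : ℕ) :
    ∫ ω, Real.exp (t * treeDist (fun k => X k ω) n (X n ω) root) ∂P =
      ∏ k ∈ Finset.Icc 1 n,
        (1 + a k / (∑ j ∈ Finset.Icc 1 k, a j) * expMean (t * a k)) := by
  rw [integral_eq_lintegral_of_nonneg_ae (ae_of_all _ fun ω => (Real.exp_pos _).le)
    (hX.integrable_exp_treeDist ha t n).1, hX.lintegral_exp_treeDist ha t n, ENNReal.toReal_ofReal]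
  exact Finset.prod_nonneg fun k hk => (one_add_mul_expMean_pos ha _ (Finset.mem_Icc.1 hk).1).le

/-- Convergence of the moment generating functions of the rescaled height of the point on which
`b_{n+1}` is glued. -/
theorem tendsto_integral_exp_treeDist_div (hX : IsGluing P a X) (ha : ∀ n, 1 ≤ n → 0 < a n)
    {α : ℝ} (hα : 0 < α) (hreg : RegularlyVarying a α) (t : ℝ) :
    Tendsto (fun n : ℕ => ∫ ω, Real.exp
        (t * (treeDist (fun k => X k ω) n (X n ω) root / a (n + 1))) ∂P) atTop
      (𝓝 (Real.exp (phi α t))) := by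
  have hp : Tendsto (fun n : ℕ => a n / ∑ j ∈ Finset.Icc 1 n, a j) atTop (𝓝 0) := by
    have h1 := ((hreg.tendsto_sum_div hα ha).inv₀ (by positivity)).mul
      tendsto_one_div_atTop_nhds_zero_nat
    rw [mul_zero] at h1
    refine h1.congr' ?_
    filter_upwards [eventually_gt_atTop 0] with n hn
    have hn0 : (n : ℝ) ≠ 0 := by exact_mod_cast hn.ne'
    rw [inv_div]
    field_simp
  have hlast : Tendsto (fun n : ℕ => 1 + a (n + 1) / (∑ j ∈ Finset.Icc 1 (n + 1), a j) * expMean t)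
      atTop (𝓝 1) := by
    simpa using ((hp.comp (tendsto_add_atTop_nat 1)).mul_const (expMean t)).const_add 1
  -- The scale is `a (n + 1)` but the product stops at `n`: the factor `k = n + 1`, which tends to
  -- `1`, is divided out.
  have h := ((tendsto_prod_one_add_mul_expMean hreg hα ha t).comp (tendsto_add_atTop_nat 1)).div
    hlast one_ne_zero
  rw [div_one] at h
  refine h.congr fun n => ?_
  have han := (ha (n + 1) (by omega)).ne'
  have hi : ∀ x : ℝ, t * (x / a (n + 1)) = t / a (n + 1) * x := fun x => by ring
  simp only [Function.comp, Pi.div_apply, hi]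
  rw [hX.integral_exp_treeDist ha, Finset.prod_Icc_succ_top (by omega), div_mul_cancel₀ _ han,
    mul_div_cancel_right₀ _ (one_add_mul_expMean_pos ha t (by omega)).ne']

end IsGluing

/-! ### Limit laws for the heights of the leaves. -/

theorem IsXiLaw.unique {α : ℝ} {μ ν : ProbabilityMeasure ℝ} (hμ : IsXiLaw α (μ : Measure ℝ))
    (hν : IsXiLaw α (ν : Measure ℝ)) : μ = ν :=
  ProbabilityMeasure.eq_of_integral_exp_mul_eq (fun t => (hμ t).1)
    fun t => (hμ t).2.trans (hν t).2.symm

theorem treeDist_leaf_div {a : ℕ → ℝ} (ha : ∀ n, 1 ≤ n → 0 < a n) (g : ℕ → ℕ × ℝ) (n : ℕ) :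
    treeDist g (n + 1) (leaf a (n + 1)) root / a (n + 1) =
      1 + treeDist g n (g n) root / a (n + 1) := by
  have han := ha (n + 1) (by omega)
  rw [leaf, treeDist_succ_root g n han.le, add_div, div_self han.ne']

section

variable {Ω : Type*} [MeasurableSpace Ω] {P : Measure Ω} [IsProbabilityMeasure P]
  {a : ℕ → ℝ} {X : ℕ → Ω → ℕ × ℝ} {α : ℝ}

namespace IsGluing

theorem exists_isXiLaw_tendsto (hX : IsGluing P a X) (ha : ∀ n, 1 ≤ n → 0 < a n)
    (hα : 0 < α) (hreg : RegularlyVarying a α) :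
    ∃ ν : ProbabilityMeasure ℝ, IsXiLaw α (ν : Measure ℝ) ∧
      Tendsto (β := ProbabilityMeasure ℝ)
        (fun n : ℕ => ⟨P.map fun ω => treeDist (fun k => X k ω) n (X n ω) root / a (n + 1),
          Measure.isProbabilityMeasure_map
            ((hX.measurable_treeDist_gluing n).div_const _).aemeasurable⟩) atTop (𝓝 ν) := by
  have hm (n : ℕ) : AEMeasurable
      (fun ω => treeDist (fun k => X k ω) n (X n ω) root / a (n + 1)) P :=
    ((hX.measurable_treeDist_gluing n).div_const _).aemeasurable
  have he (t : ℝ) : Continuous fun x : ℝ => Real.exp (t * x) := by fun_prop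
  obtain ⟨ν, h1, h2⟩ := exists_tendsto_of_tendsto_integral_exp_mul
    (M := fun t => Real.exp (phi α t))
    (μ := fun n : ℕ => ⟨P.map fun ω => treeDist (fun k => X k ω) n (X n ω) root / a (n + 1),
      Measure.isProbabilityMeasure_map (hm n)⟩)
    (fun n t => by
      refine (integrable_map_measure (he t).aestronglyMeasurable (hm n)).2 ?_
      refine (hX.integrable_exp_treeDist ha (t / a (n + 1)) n).congr (ae_of_all _ fun ω => ?_)
      simp only [Function.comp]
      ring_nf)
    (fun t => by
      refine (hX.tendsto_integral_exp_treeDist_div ha hα hreg t).congr fun n => ?_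
      exact (integral_map (hm n) (he t).aestronglyMeasurable).symm)
  exact ⟨ν, h2, h1⟩

variable {Ω' : Type*} [MeasurableSpace Ω'] {P' : Measure Ω'} [IsProbabilityMeasure P']
  {ξ : Ω' → ℝ}

theorem tendstoInDistribution_leaf (hX : IsGluing P a X) (ha : ∀ n, 1 ≤ n → 0 < a n)
    (hα : 0 < α) (hreg : RegularlyVarying a α) (hξ : Measurable ξ)
    (hlaw : IsXiLaw α (P'.map ξ)) :
    TendstoInDistribution (fun (n : ℕ) (ω : Ω) =>
      treeDist (fun k => X k ω) (n + 1) (leaf a (n + 1)) root / a (n + 1))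
      atTop (fun ω' => 1 + ξ ω') (fun _ => P) P' := by
  obtain ⟨ν, hν, hlim⟩ := hX.exists_isXiLaw_tendsto ha hα hreg
  have hνξ : ν = ⟨P'.map ξ, Measure.isProbabilityMeasure_map hξ.aemeasurable⟩ :=
    hν.unique (ν := ⟨P'.map ξ, Measure.isProbabilityMeasure_map hξ.aemeasurable⟩) hlaw
  have h : TendstoInDistribution
      (fun (n : ℕ) (ω : Ω) => treeDist (fun k => X k ω) n (X n ω) root / a (n + 1))
      atTop ξ (fun _ => P) P' :=
    ⟨fun n => ((hX.measurable_treeDist_gluing n).div_const _).aemeasurable, hξ.aemeasurable,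
      hνξ ▸ hlim⟩
  have h' := h.continuous_comp (g := fun x : ℝ => 1 + x) (by fun_prop)
  refine h'.congr (fun n => ae_of_all _ fun ω => ?_) (ae_of_all _ fun _ => rfl)
  exact (treeDist_leaf_div ha _ n).symm

/-- Slutsky's lemma: with `m = ⌊x n⌋`, the height of `L_m` over `a n` is its height over `a m` times
the deterministic ratio `a m / a n → x ^ α`. -/
theorem tendsto_integral_leaf_floor (hX : IsGluing P a X) (ha : ∀ n, 1 ≤ n → 0 < a n)
    (hα : 0 < α) (hreg : RegularlyVarying a α) (hξ : Measurable ξ)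
    (hlaw : IsXiLaw α (P'.map ξ)) (f : BoundedContinuousFunction ℝ ℝ) {x : ℝ} (hx : 0 < x) :
    Tendsto (fun n : ℕ => ∫ ω, f (treeDist (fun k => X k ω) ⌊x * (n : ℝ)⌋₊
        (leaf a ⌊x * (n : ℝ)⌋₊) root / a n) ∂P) atTop
      (𝓝 (∫ ω', f ((1 + ξ ω') * x ^ α) ∂P')) := by
  let D (m : ℕ) (ω : Ω) : ℝ := treeDist (fun k => X k ω) m (leaf a m) root
  have hD (m : ℕ) : Measurable (D m) := hX.measurable_treeDist_root m measurable_const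
  have hξ1 : Measurable fun ω' => 1 + ξ ω' := hξ.const_add 1
  have h0 : Tendsto (β := ProbabilityMeasure ℝ) (fun m : ℕ => ⟨P.map fun ω => D m ω / a m,
      Measure.isProbabilityMeasure_map ((hD m).div_const _).aemeasurable⟩) atTop
      (𝓝 ⟨P'.map fun ω' => 1 + ξ ω', Measure.isProbabilityMeasure_map hξ1.aemeasurable⟩) :=
    (tendsto_add_atTop_iff_nat 1).1 (hX.tendstoInDistribution_leaf ha hα hreg hξ hlaw).tendsto
  have hfl : Tendsto (fun n : ℕ => ⌊x * (n : ℝ)⌋₊) atTop atTop :=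
    tendsto_nat_floor_atTop.comp (tendsto_natCast_atTop_atTop.const_mul_atTop hx)
  have h1 : TendstoInDistribution
      (fun (n : ℕ) ω => D ⌊x * (n : ℝ)⌋₊ ω / a ⌊x * (n : ℝ)⌋₊) atTop
      (fun ω' => 1 + ξ ω') (fun _ => P) P' :=
    ⟨fun n => ((hD _).div_const _).aemeasurable, hξ1.aemeasurable, h0.comp hfl⟩
  have h2 : TendstoInMeasure P (fun (n : ℕ) (_ : Ω) => a ⌊x * (n : ℝ)⌋₊ / a n) atTop
      (fun _ => x ^ α) :=
    tendstoInMeasure_of_tendsto_ae (fun n => aestronglyMeasurable_const)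
      (ae_of_all _ fun _ => hreg x hx)
  have h3 := h1.continuous_comp_prodMk_of_tendstoInMeasure_const
    (g := fun y : ℝ × ℝ => y.1 * y.2) (by fun_prop) h2 (fun n => aemeasurable_const)
  have h4 := ProbabilityMeasure.tendsto_iff_forall_integral_tendsto.1 h3.tendsto f
  simp only [ProbabilityMeasure.coe_mk] at h4
  rw [integral_map (by fun_prop) f.continuous.aestronglyMeasurable] at h4
  refine h4.congr' ?_
  filter_upwards [hfl.eventually_ge_atTop 1] with n hn
  rw [integral_map (h3.forall_aemeasurable n) f.continuous.aestronglyMeasurable]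
  refine integral_congr_ae (ae_of_all _ fun ω => ?_)
  simp only [D]
  rw [div_mul_div_cancel₀ (ha _ hn).ne']

end IsGluing

theorem IsUniformLeafIndex.integral_leaf {n : ℕ} {J : Ω → ℕ} (hJ : IsUniformLeafIndex P X n J)
    (hX : IsGluing P a X) (f : BoundedContinuousFunction ℝ ℝ) (c : ℝ) :
    ∫ ω, f (treeDist (fun k => X k ω) n (leaf a (J ω)) root / c) ∂P =
      ∑ k ∈ Finset.Icc 1 n,
        (∫ ω, f (treeDist (fun k => X k ω) k (leaf a k) root / c) ∂P) / n := by
  let Y : Ω → Finset.Ico 1 n → ℕ × ℝ := fun ω k => X k ω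
  have hY : Measurable Y := hX.measurable_restrict n
  have : IsProbabilityMeasure (P.map Y) := Measure.isProbabilityMeasure_map hY.aemeasurable
  have : IsProbabilityMeasure (P.map J) :=
    Measure.isProbabilityMeasure_map hJ.measurable.aemeasurable
  have hleaf : Measurable (leaf a) := measurable_from_nat
  have hF : Measurable fun x : ℕ × (Finset.Ico 1 n → ℕ × ℝ) =>
      f (treeDist (extend n x.2) n (leaf a x.1) root / c) :=
    f.continuous.measurable.comp (((measurable_treeDist_extend_root n).comp
      ((hleaf.comp measurable_fst).prodMk measurable_snd)).div_const c)
  have hext (ω : Ω) (p : ℕ × ℝ) :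
      treeDist (extend n (Y ω)) n p root = treeDist (fun k => X k ω) n p root :=
    treeDist_extend (fun k => X k ω) n p root
  have hprod := (indepFun_iff_map_prod_eq_prod_map_map hJ.measurable.aemeasurable
    hY.aemeasurable).1 hJ.indep
  have hFi : Integrable (fun x : ℕ × (Finset.Ico 1 n → ℕ × ℝ) =>
      f (treeDist (extend n x.2) n (leaf a x.1) root / c)) ((P.map J).prod (P.map Y)) :=
    Integrable.of_bound hF.aestronglyMeasurable ‖f‖ (ae_of_all _ fun _ => f.norm_coe_le_norm _)
  have hin (k : ℕ) : ∫ v, f (treeDist (extend n v) n (leaf a k) root / c) ∂(P.map Y) =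
      ∫ ω, f (treeDist (fun k => X k ω) n (leaf a k) root / c) ∂P := by
    rw [integral_map hY.aemeasurable (f := fun v => f (treeDist (extend n v) n (leaf a k) root / c))
      (hF.comp measurable_prodMk_left).aestronglyMeasurable]
    simp only [hext]
  calc ∫ ω, f (treeDist (fun k => X k ω) n (leaf a (J ω)) root / c) ∂P
      = ∫ ω, f (treeDist (extend n (Y ω)) n (leaf a (J ω)) root / c) ∂P := by simp only [hext]
    _ = ∫ x, f (treeDist (extend n x.2) n (leaf a x.1) root / c) ∂(P.map fun ω => (J ω, Y ω)) :=
        (integral_map (hJ.measurable.prodMk hY).aemeasurable hF.aestronglyMeasurable).symm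
    _ = ∫ k, ∫ ω, f (treeDist (fun k => X k ω) n (leaf a k) root / c) ∂P ∂(P.map J) := by
        rw [hprod, integral_prod _ hFi]
        simp only [hin]
    _ = ∑ k ∈ Finset.Icc 1 n,
        (∫ ω, f (treeDist (fun k => X k ω) n (leaf a k) root / c) ∂P) / n := by
        rw [hJ.uniform, ProbabilityTheory.cond, integral_smul_measure, ← Finset.coe_Icc,
          setIntegral_finset, Measure.count_apply_finset,
          Finset.smul_sum]
        · refine Finset.sum_congr rfl fun k _ => ?_
          simp [measureReal_def, div_eq_inv_mul]
        · rw [← Set.biUnion_of_singleton ((Finset.Icc 1 n : Finset ℕ) : Set ℕ),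
            integrableOn_finite_biUnion (Finset.finite_toSet _)]
          exact fun k _ => integrableOn_singleton (by simp) (by simp)
    -- Later gluings do not change the height of `L_k`, so it may be computed in `T_k`.
    _ = _ := by
        refine Finset.sum_congr rfl fun k hk => ?_
        rw [Finset.mem_Icc] at hk
        simp only [treeDist_root_of_le _ hk.1 (p := leaf a k) le_rfl hk.2]

end

/-- Conditioning on `U` puts the limit in the form of the integral to which the average over leaves
converges. -/
theorem integral_mul_uniform_rpow {Ω' : Type*} [MeasurableSpace Ω'] {P' : Measure Ω'}
    [IsProbabilityMeasure P'] {ξ U : Ω' → ℝ} (hξ : Measurable ξ) (hU : Measurable U)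
    (hunif : pdf.IsUniform U (Set.Ioo 0 1) P' volume) (hind : IndepFun ξ U P')
    (f : BoundedContinuousFunction ℝ ℝ) (α : ℝ) :
    ∫ ω', f ((1 + ξ ω') * U ω' ^ α) ∂P' =
      ∫ x in (0 : ℝ)..1, ∫ ω', f ((1 + ξ ω') * x ^ α) ∂P' := by
  have : IsProbabilityMeasure (P'.map ξ) := Measure.isProbabilityMeasure_map hξ.aemeasurable
  have : IsProbabilityMeasure (P'.map U) := Measure.isProbabilityMeasure_map hU.aemeasurable
  have hF : Measurable fun x : ℝ × ℝ => f ((1 + x.2) * x.1 ^ α) :=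
    f.continuous.measurable.comp (by fun_prop)
  have hFi : Integrable (fun x : ℝ × ℝ => f ((1 + x.2) * x.1 ^ α))
      ((P'.map U).prod (P'.map ξ)) :=
    Integrable.of_bound hF.aestronglyMeasurable ‖f‖ (ae_of_all _ fun _ => f.norm_coe_le_norm _)
  have hin (x : ℝ) : ∫ y, f ((1 + y) * x ^ α) ∂(P'.map ξ) = ∫ ω', f ((1 + ξ ω') * x ^ α) ∂P' :=
    integral_map hξ.aemeasurable (hF.comp measurable_prodMk_left).aestronglyMeasurable
  calc ∫ ω', f ((1 + ξ ω') * U ω' ^ α) ∂P'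
      = ∫ x, f ((1 + x.2) * x.1 ^ α) ∂(P'.map fun ω' => (U ω', ξ ω')) :=
        (integral_map (hU.prodMk hξ).aemeasurable hF.aestronglyMeasurable).symm
    _ = ∫ x, ∫ ω', f ((1 + ξ ω') * x ^ α) ∂P' ∂(P'.map U) := by
        rw [(indepFun_iff_map_prod_eq_prod_map_map hU.aemeasurable hξ.aemeasurable).1 hind.symm,
          integral_prod _ hFi]
        simp only [hin]
    _ = _ := by
        rw [hunif, ProbabilityTheory.cond, intervalIntegral.integral_of_le zero_le_one,
          integral_Ioc_eq_integral_Ioo]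
        simp

theorem tendstoInDistribution_uniform_leaf {Ω : Type*} [MeasurableSpace Ω] {P : Measure Ω}
    [IsProbabilityMeasure P] {a : ℕ → ℝ} {X : ℕ → Ω → ℕ × ℝ} {α : ℝ} (hX : IsGluing P a X)
    (ha : ∀ n, 1 ≤ n → 0 < a n) (hα : 0 < α) (hreg : RegularlyVarying a α)
    {J : ℕ → Ω → ℕ} (hJ : ∀ n, 1 ≤ n → IsUniformLeafIndex P X n (J n))
    {Ω' : Type*} [MeasurableSpace Ω'] {P' : Measure Ω'} [IsProbabilityMeasure P']
    {ξ U : Ω' → ℝ} (hξ : Measurable ξ) (hU : Measurable U) (hlaw : IsXiLaw α (P'.map ξ))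
    (hunif : pdf.IsUniform U (Set.Ioo 0 1) P' volume) (hind : IndepFun ξ U P') :
    TendstoInDistribution
      (fun (n : ℕ) (ω : Ω) => treeDist (fun k => X k ω) (n + 1) (leaf a (J (n + 1) ω)) root /
        a (n + 1))
      atTop (fun ω' => (1 + ξ ω') * U ω' ^ α) (fun _ => P) P' := by
  have hleaf : Measurable (leaf a) := measurable_from_nat
  have hm (n : ℕ) : AEMeasurable (fun ω => treeDist (fun k => X k ω) (n + 1)
      (leaf a (J (n + 1) ω)) root / a (n + 1)) P :=
    ((hX.measurable_treeDist_root (n + 1)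
      (hleaf.comp (hJ (n + 1) (by omega)).measurable)).div_const _).aemeasurable
  have hlm : AEMeasurable (fun ω' => (1 + ξ ω') * U ω' ^ α) P' := by fun_prop
  refine ⟨hm, hlm, ProbabilityMeasure.tendsto_iff_forall_integral_tendsto.2 fun f => ?_⟩
  simp only [ProbabilityMeasure.coe_mk]
  rw [integral_map hlm f.continuous.aestronglyMeasurable,
    integral_mul_uniform_rpow hξ hU hunif hind]
  have hsum : Tendsto (fun n : ℕ => ∑ k ∈ Finset.Icc 1 n,
      (∫ ω, f (treeDist (fun k => X k ω) k (leaf a k) root / a n) ∂P) / n) atTop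
      (𝓝 (∫ x in (0 : ℝ)..1, ∫ ω', f ((1 + ξ ω') * x ^ α) ∂P')) := by
    refine tendsto_sum_Icc_of_dominated (C := ‖f‖) (β := 1) one_pos le_rfl
      (fun n k hk hkn => ?_) (fun x hx => ?_)
    · rw [abs_div, Nat.abs_cast, sub_self, Real.rpow_zero, mul_one]
      refine div_le_div_of_nonneg_right ?_ (Nat.cast_nonneg n)
      have := norm_integral_le_of_norm_le_const (μ := P)
        (f := fun ω => f (treeDist (fun k => X k ω) k (leaf a k) root / a n))
        (ae_of_all _ fun ω => f.norm_coe_le_norm _)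
      simpa using this
    · refine (hX.tendsto_integral_leaf_floor ha hα hreg hξ hlaw f hx.1).congr' ?_
      filter_upwards [eventually_gt_atTop 0] with n hn
      have hn0 : (n : ℝ) ≠ 0 := by exact_mod_cast hn.ne'
      rw [mul_div_cancel₀ _ hn0]
  refine (hsum.comp (tendsto_add_atTop_nat 1)).congr fun n => ?_
  rw [integral_map (hm n) f.continuous.aestronglyMeasurable,
    (hJ (n + 1) (by omega)).integral_leaf hX, Function.comp]

end LineBreaking

end

theorem mainTheorem7 (α : ℝ) (hα : 0 < α) (a : ℕ → ℝ) (ha : ∀ n, 1 ≤ n → 0 < a n)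
    (hreg : RegularlyVarying a α)
    {Ω : Type*} [MeasurableSpace Ω] (P : Measure Ω) [IsProbabilityMeasure P]
    (X : ℕ → Ω → ℕ × ℝ) (hX : LineBreaking.IsGluing P a X)
    (J : ℕ → Ω → ℕ) (hJ : ∀ n, 1 ≤ n → LineBreaking.IsUniformLeafIndex P X n (J n)) :
    (∃! ν : ProbabilityMeasure ℝ, LineBreaking.IsXiLaw α (ν : Measure ℝ)) ∧
    ∀ {Ω' : Type*} [MeasurableSpace Ω'] (P' : Measure Ω') [IsProbabilityMeasure P']
      (ξ U : Ω' → ℝ), Measurable ξ → Measurable U →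
      LineBreaking.IsXiLaw α (P'.map ξ) →
      pdf.IsUniform U (Set.Ioo 0 1) P' volume →
      IndepFun ξ U P' →
      TendstoInDistribution
        (fun (n : ℕ) (ω : Ω) =>
          LineBreaking.treeDist (fun k => X k ω) (n + 1)
            (LineBreaking.leaf a (n + 1)) LineBreaking.root / a (n + 1))
        atTop (fun ω' => 1 + ξ ω') (fun _ => P) P' ∧
      TendstoInDistribution
        (fun (n : ℕ) (ω : Ω) =>
          LineBreaking.treeDist (fun k => X k ω) (n + 1)
            (LineBreaking.leaf a (J (n + 1) ω)) LineBreaking.root / a (n + 1))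
        atTop (fun ω' => (1 + ξ ω') * U ω' ^ α) (fun _ => P) P' := by
  refine ⟨?_, fun P' _ ξ U hξ hU hlaw hunif hind =>
    ⟨hX.tendstoInDistribution_leaf ha hα hreg hξ hlaw,
      LineBreaking.tendstoInDistribution_uniform_leaf hX ha hα hreg hJ hξ hU hlaw hunif hind⟩⟩
  -- The law of `ξ` exists as the weak limit of the rescaled gluing heights.
  obtain ⟨ν, hν, -⟩ := hX.exists_isXiLaw_tendsto ha hα hreg
  exact ⟨ν, hν, fun ν' hν' => hν'.unique hν⟩
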